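/- Let $\mathbf{Top}$ be the category of weakly Hausdorff $k$-spaces and continuous maps, with its cartesian monoidal structure ($k$-ified products), and fix any model structure on it (for instance the Quillen, the Strøm or the mixed one). Let $\mathcal M$ be a $\mathbf{Top}$-enriched model category, that is, a model category having all small colimits which is enriched, tensored and cotensored over $\mathbf{Top}$, with tensor $\square:\mathcal M\times\mathbf{Top}\to\mathcal M$, and such that for all cofibrations $i:A\to B$ in $\mathcal M$ and $j:K\to L$ in $\mathbf{Top}$ the map $$(B\,\square\, K)\cup_{A\square K}(A\,\square\, L)\longrightarrow B\,\square\, L$$ is a cofibration, which is moreover a weak equivalence if $i$ or $j$ is one. A simplicial object $X_\cdot$ of $\mathcal M$ is called Reedy cofibrant if for every $n\ge 0$ the latching map $L_nX_\cdot=\operatorname{colim}_{[n]\twoheadrightarrow[m],\,m<n}X_m\to X_n$ is a cofibration, and a cosimplicial object $I^\cdot$ of $\mathbf{Top}$ is called Reedy cofibrant if for every $n\ge 0$ the latching map $L^nI^\cdot=\operatorname{colim}_{[m]\rightarrowtail[n],\,m<n}I^m\to I^n$ is a cofibration. Let $f_\cdot:X_\cdot\to Y_\cdot$ be a morphism of Reedy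 cofibrant simplicial objects of $\mathcal M$ such that each $f_n:X_n\to Y_n$ is a weak equivalence, and let $g^\cdot:I^\cdot\to J^\cdot$ be a morphism of Reedy cofibrant cosimplicial objects of $\mathbf{Top}$ such that each $g^n:I^n\to J^n$ is a weak equivalence. Then the induced map of coends over the simplex category $\triangle$ $$\int^{\triangle}f_\cdot\,\square\,g^\cdot:\ \int^{\triangle}X_\cdot\,\square\,I^\cdot\longrightarrow\int^{\triangle}Y_\cdot\,\square\,J^\cdot$$ is a weak equivalence in $\mathcal M$. -/

import Mathlib

open CategoryTheory Limits MonoidalCategory HomotopicalAlgebra Opposite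

universe w v v' u u'

attribute [-instance] catToReflQuiver

/-! ### Weakly Hausdorff `k`-spaces -/

/-- A space is weakly Hausdorff if the image of every continuous map from a compact Hausdorff
space is closed. -/
class WeaklyHausdorffSpace (X : Type w) [TopologicalSpace X] : Prop where
  isClosed_range (K : Type w) [TopologicalSpace K] [CompactSpace K] [T2Space K] (f : K → X)
    (hf : Continuous f) : IsClosed (Set.range f)

/-- The property of being a weakly Hausdorff `k`-space, where a `k`-space is a space whose
topology is final with respect to all continuous maps from compact Hausdorff spaces. -/
def isWeaklyHausdorffKSpace : ObjectProperty TopCat.{w} :=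
  fun X => CompactlyGeneratedSpace X ∧ WeaklyHausdorffSpace X

/-- The category of weakly Hausdorff `k`-spaces and continuous maps. -/
abbrev KTop : Type (w + 1) := isWeaklyHausdorffKSpace.{w}.FullSubcategory

namespace KTop

/-- The family of all compact Hausdorff spaces. -/
abbrev compactFamily : CompHaus.{w} → Type w := fun K => K

lemma compactlyGeneratedSpace_iff (X : Type w) [TopologicalSpace X] :
    CompactlyGeneratedSpace X ↔ Topology.IsGeneratedBy compactFamily.{w} X := by
  rw [Topology.IsGeneratedBy.iff_le_generatedBy, TopologicalSpace.generatedBy_eq_coinduced]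
  exact ⟨fun h => h.le_compactlyGenerated, fun h => ⟨h⟩⟩

/-- The `k`-ification of the product topology on `X × Y`. -/
abbrev KProd (X Y : Type w) [TopologicalSpace X] [TopologicalSpace Y] : Type w :=
  Topology.WithGeneratedByTopology compactFamily.{w} (X × Y)

lemma weaklyHausdorffSpace_kProd (X Y : Type w) [TopologicalSpace X] [TopologicalSpace Y]
    [hX : WeaklyHausdorffSpace X] [hY : WeaklyHausdorffSpace Y] :
    WeaklyHausdorffSpace (KProd X Y) where
  isClosed_range K _ _ _ f hf := by
    have closedMap : ∀ (Z : Type w) [TopologicalSpace Z] [WeaklyHausdorffSpace Z] (g : K → Z),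
        Continuous g → ∀ C : Set K, IsClosed C → IsClosed (g '' C) := by
      intro Z _ hZ g hg C hC
      have : CompactSpace C := isCompact_iff_compactSpace.mp hC.isCompact
      have h := hZ.isClosed_range C (fun c => g c) (by fun_prop)
      rwa [Set.image_eq_range]
    have closedPt : ∀ (Z : Type w) [TopologicalSpace Z] [WeaklyHausdorffSpace Z] (z : Z),
        IsClosed ({z} : Set Z) := by
      intro Z _ hZ z
      have h := hZ.isClosed_range PUnit (fun _ => z) (by fun_prop)
      rwa [Set.range_const] at h
    let p : K → X × Y := fun k => Topology.WithGeneratedByTopology.equiv (f k)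
    have hp : Continuous p := Topology.WithGeneratedByTopology.continuous_equiv.comp hf
    have hp1 : Continuous fun k => (p k).1 := by fun_prop
    have hp2 : Continuous fun k => (p k).2 := by fun_prop
    have key : IsClosed (Set.range p) := by
      rw [← isOpen_compl_iff, isOpen_iff_mem_nhds]
      rintro ⟨x, y⟩ hxy
      have hdisj : Disjoint ((fun k => (p k).1) ⁻¹' {x}) ((fun k => (p k).2) ⁻¹' {y}) := by
        rw [Set.disjoint_left]
        intro k hk1 hk2
        exact hxy ⟨k, Prod.ext hk1 hk2⟩
      obtain ⟨U, W, hU, hW, hAU, hBW, hUW⟩ :=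
        normal_separation ((closedPt X x).preimage hp1) ((closedPt Y y).preimage hp2) hdisj
      have c1 := closedMap X _ hp1 Uᶜ hU.isClosed_compl
      have c2 := closedMap Y _ hp2 Wᶜ hW.isClosed_compl
      have n1 : ((fun k => (p k).1) '' Uᶜ)ᶜ ∈ nhds x :=
        c1.isOpen_compl.mem_nhds (by rintro ⟨k, hk, rfl⟩; exact hk (hAU rfl))
      have n2 : ((fun k => (p k).2) '' Wᶜ)ᶜ ∈ nhds y :=
        c2.isOpen_compl.mem_nhds (by rintro ⟨k, hk, rfl⟩; exact hk (hBW rfl))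
      filter_upwards [prod_mem_nhds n1 n2]
      rintro _ ⟨h1, h2⟩ ⟨k, rfl⟩
      have hkU : k ∈ U := by
        by_contra h
        exact h1 ⟨k, h, rfl⟩
      have hkW : k ∈ W := by
        by_contra h
        exact h2 ⟨k, h, rfl⟩
      exact Set.disjoint_left.mp hUW hkU hkW
    have := key.preimage (Topology.WithGeneratedByTopology.continuous_equiv
      (X := compactFamily.{w}))
    convert! this using 1

lemma weaklyHausdorffSpace_pUnit : WeaklyHausdorffSpace PUnit.{w + 1} where
  isClosed_range _ _ _ _ _ _ := isClosed_discrete _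

/-- The one-point space. -/
def point : KTop.{w} :=
  ⟨TopCat.of PUnit, (compactlyGeneratedSpace_iff _).mpr inferInstance,
    weaklyHausdorffSpace_pUnit⟩

/-- The one-point space is terminal. -/
def isTerminalPoint : IsTerminal point.{w} :=
  IsTerminal.ofUniqueHom (fun _ => ObjectProperty.homMk (TopCat.ofHom ⟨fun _ => PUnit.unit, by
    fun_prop⟩)) (fun _ _ => by ext; rfl)

/-- The product of two weakly Hausdorff `k`-spaces: the `k`-ification of the product topology. -/
def prod (X Y : KTop.{w}) : KTop.{w} :=
  ⟨TopCat.of (KProd X.obj Y.obj), (compactlyGeneratedSpace_iff _).mpr inferInstance,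
    have := X.property.2
    have := Y.property.2
    weaklyHausdorffSpace_kProd _ _⟩

/-- The first projection. -/
def fst (X Y : KTop.{w}) : prod X Y ⟶ X :=
  ObjectProperty.homMk (TopCat.ofHom ⟨fun z => (Topology.WithGeneratedByTopology.equiv z).1,
    continuous_fst.comp Topology.WithGeneratedByTopology.continuous_equiv⟩)

/-- The second projection. -/
def snd (X Y : KTop.{w}) : prod X Y ⟶ Y :=
  ObjectProperty.homMk (TopCat.ofHom ⟨fun z => (Topology.WithGeneratedByTopology.equiv z).2,
    continuous_snd.comp Topology.WithGeneratedByTopology.continuous_equiv⟩)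

/-- The map into the product with given components. -/
def lift {T X Y : KTop.{w}} (f : T ⟶ X) (g : T ⟶ Y) : T ⟶ prod X Y :=
  ObjectProperty.homMk (TopCat.ofHom
    ⟨fun t => Topology.WithGeneratedByTopology.equiv.symm (f.hom t, g.hom t), by
      have : Topology.IsGeneratedBy compactFamily.{w} T.obj :=
        (compactlyGeneratedSpace_iff _).mp T.property.1
      exact (Topology.IsGeneratedBy.equiv_symm_comp_continuous_iff (X := compactFamily.{w})
        (fun t => (f.hom t, g.hom t))).mpr (by fun_prop)⟩)

/-- `prod X Y` is a product of `X` and `Y` in the category of weakly Hausdorff `k`-spaces. -/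
def isLimitProd (X Y : KTop.{w}) : IsLimit (BinaryFan.mk (fst X Y) (snd X Y)) :=
  BinaryFan.IsLimit.mk _ (fun f g => lift f g) (fun _ _ => rfl) (fun _ _ => rfl) (by
    rintro T f g m rfl rfl
    ext t
    rfl)

/-- The category of weakly Hausdorff `k`-spaces with its cartesian monoidal structure. -/
noncomputable instance : CartesianMonoidalCategory KTop.{w} :=
  .ofChosenFiniteProducts ⟨_, isTerminalPoint⟩ (fun X Y => ⟨_, isLimitProd X Y⟩)

end KTop

/-! ### Tensored and cotensored enriched categories -/

section Enriched

/-- A `V`-enriched category is tensored if for all objects `X` of `M` and `K` of `V` there is an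
object `X □ K` which represents `K ⟶ (X ⟶[V] -)` in the enriched sense: `unit` induces a
bijection, natural in `W` and `B`, between morphisms `W ⟶ (X □ K ⟶[V] B)` and morphisms
`K ⊗ W ⟶ (X ⟶[V] B)` of `V`. When `V` is closed this says that `X □ K ⟶[V] B` is the internal
hom from `K` to `X ⟶[V] B`. -/
class TensoredCategory (V : Type u') [Category.{v'} V] [MonoidalCategory V]
    (M : Type u) [Category.{v} M] [EnrichedOrdinaryCategory V M] where
  /-- the tensor `X □ K` -/
  tensor : M → V → M
  /-- the universal morphism -/
  unit (X : M) (K : V) : K ⟶ (X ⟶[V] tensor X K)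
  bijective (X : M) (K W : V) (B : M) :
    Function.Bijective (fun φ : W ⟶ (tensor X K ⟶[V] B) =>
      (unit X K ⊗ₘ φ) ≫ eComp V X (tensor X K) B)

/-- A `V`-enriched category is cotensored if for all objects `K` of `V` and `B` of `M` there is
an object `B ^ K` such that `counit` induces a bijection, natural in `W` and `A`, between
morphisms `W ⟶ (A ⟶[V] B ^ K)` and morphisms `W ⊗ K ⟶ (A ⟶[V] B)` of `V`. -/
class CotensoredCategory (V : Type u') [Category.{v'} V] [MonoidalCategory V]
    (M : Type u) [Category.{v} M] [EnrichedOrdinaryCategory V M] where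
  /-- the cotensor `B ^ K` -/
  cotensor : V → M → M
  /-- the universal morphism -/
  counit (K : V) (B : M) : K ⟶ (cotensor K B ⟶[V] B)
  bijective (K W : V) (A B : M) :
    Function.Bijective (fun φ : W ⟶ (A ⟶[V] cotensor K B) =>
      (φ ⊗ₘ counit K B) ≫ eComp V A (cotensor K B) B)

namespace TensoredCategory

variable (V : Type u') [Category.{v'} V] [MonoidalCategory V]
  {M : Type u} [Category.{v} M] [EnrichedOrdinaryCategory V M] [TensoredCategory V M]

lemma bijective_unit_comp (X : M) (K : V) (B : M) :
    Function.Bijective (fun g : tensor X K ⟶ B => unit X K ≫ eHomWhiskerLeft V X g) := by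
  have h := (bijective X K (𝟙_ V) B).comp (eHomEquiv V (X := tensor X K) (Y := B)).bijective
  have h' : Function.Bijective (fun φ : K ⊗ 𝟙_ V ⟶ (X ⟶[V] B) => (ρ_ K).inv ≫ φ) :=
    ((ρ_ K).homFromEquiv (Z := (X ⟶[V] B))).bijective
  convert h'.comp h using 1
  funext g
  simp [eHomWhiskerLeft, MonoidalCategory.tensorHom_def]

/-- Morphisms `X □ K ⟶ B` correspond to morphisms `K ⟶ (X ⟶[V] B)`. -/
noncomputable def homEquiv (X : M) (K : V) (B : M) : (tensor X K ⟶ B) ≃ (K ⟶ (X ⟶[V] B)) :=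
  Equiv.ofBijective _ (bijective_unit_comp V X K B)

lemma homEquiv_apply {X : M} {K : V} {B : M} (g : tensor X K ⟶ B) :
    homEquiv V X K B g = unit X K ≫ eHomWhiskerLeft V X g := rfl

variable {V}

/-- The morphism `f □ k : X □ K ⟶ Y □ L`. -/
noncomputable def tensorMap {X Y : M} {K L : V} (f : X ⟶ Y) (k : K ⟶ L) :
    tensor X K ⟶ tensor Y L :=
  (homEquiv V X K (tensor Y L)).symm (k ≫ unit Y L ≫ eHomWhiskerRight V f (tensor Y L))

lemma unit_tensorMap {X Y : M} {K L : V} (f : X ⟶ Y) (k : K ⟶ L) :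
    unit X K ≫ eHomWhiskerLeft V X (tensorMap f k) =
      k ≫ unit Y L ≫ eHomWhiskerRight V f (tensor Y L) :=
  (homEquiv V X K (tensor Y L)).apply_symm_apply _

lemma tensorMap_id (X : M) (K : V) : tensorMap (𝟙 X) (𝟙 K) = 𝟙 (tensor X K) := by
  apply (homEquiv V _ _ _).injective
  simp [homEquiv_apply, unit_tensorMap]

lemma tensorMap_comp {X Y Z : M} {K L N : V} (f : X ⟶ Y) (f' : Y ⟶ Z) (k : K ⟶ L)
    (k' : L ⟶ N) : tensorMap (f ≫ f') (k ≫ k') = tensorMap f k ≫ tensorMap f' k' := by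
  apply (homEquiv V _ _ _).injective
  simp only [homEquiv_apply, unit_tensorMap, eHomWhiskerLeft_comp, eHomWhiskerRight_comp]
  rw [← Category.assoc (unit X K), unit_tensorMap]
  simp only [Category.assoc]
  rw [← eHom_whisker_exchange, ← Category.assoc (unit Y L), unit_tensorMap]
  simp only [Category.assoc]

variable (V M)

/-- The bifunctor `(X, K) ↦ X □ K`. -/
@[simps]
noncomputable def tensorBifunctor : M ⥤ V ⥤ M where
  obj X :=
    { obj := fun K => tensor X K
      map := fun k => tensorMap (𝟙 X) k
      map_id := fun K => tensorMap_id X K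
      map_comp := fun k k' => by rw [← tensorMap_comp, Category.comp_id] }
  map f :=
    { app := fun K => tensorMap f (𝟙 K)
      naturality := fun _ _ k => by simp [← tensorMap_comp] }
  map_id X := by
    ext K
    exact tensorMap_id X K
  map_comp f g := by
    ext K
    simp [← tensorMap_comp]

variable {V M}

/-- The bifunctor `([n], [m]) ↦ X_n □ I^m` of a simplicial object `X` of `M` and a cosimplicial
object `I` of `V`. -/
@[simps]
noncomputable abbrev simplicialTensor (X : SimplexCategoryᵒᵖ ⥤ M) (I : SimplexCategory ⥤ V) :
    SimplexCategoryᵒᵖ ⥤ SimplexCategory ⥤ M where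
  obj n :=
    { obj := fun m => tensor (X.obj n) (I.obj m)
      map := fun b => tensorMap (𝟙 (X.obj n)) (I.map b)
      map_id := fun m => by rw [I.map_id, tensorMap_id]
      map_comp := fun b b' => by rw [← tensorMap_comp, Category.comp_id, I.map_comp] }
  map a :=
    { app := fun m => tensorMap (X.map a) (𝟙 (I.obj m))
      naturality := fun _ _ b => by simp [← tensorMap_comp] }
  map_id n := by
    ext m
    simp [tensorMap_id]
  map_comp a a' := by
    ext m
    simp [← tensorMap_comp]

/-- The natural transformation `X □ I ⟶ Y □ J` with components `f_n □ g^m`. -/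
@[simps]
noncomputable def simplicialTensorMap {X Y : SimplexCategoryᵒᵖ ⥤ M} {I J : SimplexCategory ⥤ V}
    (f : X ⟶ Y) (g : I ⟶ J) : simplicialTensor X I ⟶ simplicialTensor Y J where
  app n :=
    { app := fun m => tensorMap (f.app n) (g.app m)
      naturality := fun m m' b => by
        change tensorMap _ _ ≫ tensorMap _ _ = tensorMap _ _ ≫ tensorMap _ _
        rw [← tensorMap_comp, ← tensorMap_comp, g.naturality, Category.id_comp,
          Category.comp_id] }
  naturality n n' a := by
    ext m
    change tensorMap _ _ ≫ tensorMap _ _ = tensorMap _ _ ≫ tensorMap _ _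
    rw [← tensorMap_comp, ← tensorMap_comp, f.naturality, Category.id_comp, Category.comp_id]

end TensoredCategory

/-- The compatibility of the tensor with the model structures of `V` and `M`: for cofibrations
`i : A ⟶ B` in `M` and `j : K ⟶ L` in `V` the map
`(B □ K) ∪_(A □ K) (A □ L) ⟶ B □ L` is a cofibration, which is trivial if `i` or `j` is. -/
class PushoutProductAxiom (V : Type u') [Category.{v'} V] [MonoidalCategory V] [ModelCategory V]
    (M : Type u) [Category.{v} M] [ModelCategory M] [EnrichedOrdinaryCategory V M]
    [TensoredCategory V M] : Prop where
  cofibration {A B : M} {K L : V} (i : A ⟶ B) (j : K ⟶ L) (hi : Cofibration i)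
    (hj : Cofibration j) : Cofibration
      (Functor.PushoutObjObj.ofHasPushout (TensoredCategory.tensorBifunctor V M) i j).ι
  weakEquivalence_left {A B : M} {K L : V} (i : A ⟶ B) (j : K ⟶ L) (hi : Cofibration i)
    (hj : Cofibration j) (hi' : WeakEquivalence i) : WeakEquivalence
      (Functor.PushoutObjObj.ofHasPushout (TensoredCategory.tensorBifunctor V M) i j).ι
  weakEquivalence_right {A B : M} {K L : V} (i : A ⟶ B) (j : K ⟶ L) (hi : Cofibration i)
    (hj : Cofibration j) (hj' : WeakEquivalence j) : WeakEquivalence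
      (Functor.PushoutObjObj.ofHasPushout (TensoredCategory.tensorBifunctor V M) i j).ι

end Enriched

/-! ### Latching objects and Reedy cofibrant objects -/

namespace Reedy

/-- The non-identity surjections `[n] ↠ [m]`, `m < n`, with the morphisms under `[n]`. -/
abbrev SurjectionsFrom (n : SimplexCategory) : Type :=
  ObjectProperty.FullSubcategory (fun σ : Under n => Epi σ.hom ∧ σ.right.len < n.len)

/-- The non-identity injections `[m] ↣ [n]`, `m < n`, with the morphisms over `[n]`. -/
abbrev InjectionsTo (n : SimplexCategory) : Type :=
  ObjectProperty.FullSubcategory (fun δ : Over n => Mono δ.hom ∧ δ.left.len < n.len)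

instance finite_hom (a b : SimplexCategory) : Finite (a ⟶ b) :=
  Finite.of_injective (fun f => (f.toOrderHom : Fin (a.len + 1) → Fin (b.len + 1)))
    (fun _ _ h => SimplexCategory.Hom.ext _ _ (OrderHom.ext _ _ h))

instance (n : SimplexCategory) : Finite (SurjectionsFrom n) :=
  Finite.of_surjective
    (α := {p : (Σ m : Fin n.len, n ⟶ SimplexCategory.mk m) // Epi p.2})
    (fun p => ⟨Under.mk p.1.2, p.2, p.1.1.2⟩) (by
      rintro ⟨⟨⟨⟨⟩⟩, m, σ⟩, h, h'⟩
      exact ⟨⟨⟨⟨m.len, h'⟩, σ⟩, h⟩, rfl⟩)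

instance (n : SimplexCategory) : Finite (InjectionsTo n) :=
  Finite.of_surjective
    (α := {p : (Σ m : Fin n.len, SimplexCategory.mk m ⟶ n) // Mono p.2})
    (fun p => ⟨Over.mk p.1.2, p.2, p.1.1.2⟩) (by
      rintro ⟨⟨m, ⟨⟨⟩⟩, δ⟩, h, h'⟩
      exact ⟨⟨⟨⟨m.len, h'⟩, δ⟩, h⟩, rfl⟩)

noncomputable instance (n : SimplexCategory) : FinCategory (SurjectionsFrom n) where
  fintypeObj := Fintype.ofFinite _
  fintypeHom a b :=
    have : Finite (a ⟶ b) := Finite.of_injective (fun f => f.hom.right) (by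
      intro f g h
      ext1
      exact Under.UnderMorphism.ext h)
    Fintype.ofFinite _

noncomputable instance (n : SimplexCategory) : FinCategory (InjectionsTo n) where
  fintypeObj := Fintype.ofFinite _
  fintypeHom a b :=
    have : Finite (a ⟶ b) := Finite.of_injective (fun f => f.hom.left) (by
      intro f g h
      ext1
      exact Over.OverMorphism.ext h)
    Fintype.ofFinite _

variable {C : Type u} [Category.{v} C]

/-- The diagram `([n] ↠ [m]) ↦ X_m`. -/
def latchingDiagram (X : SimplexCategoryᵒᵖ ⥤ C) (n : SimplexCategory) : (SurjectionsFrom n)ᵒᵖ ⥤ C :=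
  (ObjectProperty.ι _ ⋙ Under.forget n).op ⋙ X

/-- The degeneracies `X_m ⟶ X_n` form a cocone. -/
@[simps]
def latchingCocone (X : SimplexCategoryᵒᵖ ⥤ C) (n : SimplexCategory) :
    Cocone (latchingDiagram X n) where
  pt := X.obj (op n)
  ι :=
    { app := fun σ => X.map σ.unop.obj.hom.op
      naturality := fun σ τ φ => by
        have h : X.map φ.unop.hom.right.op ≫ X.map τ.unop.obj.hom.op =
            X.map σ.unop.obj.hom.op := by
          rw [← X.map_comp, ← op_comp, Under.w]
        exact h.trans (Category.comp_id _).symm }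

/-- The diagram `([m] ↣ [n]) ↦ I^m`. -/
def colatchingDiagram (I : SimplexCategory ⥤ C) (n : SimplexCategory) : InjectionsTo n ⥤ C :=
  (ObjectProperty.ι _ ⋙ Over.forget n) ⋙ I

/-- The cofaces `I^m ⟶ I^n` form a cocone. -/
@[simps]
def colatchingCocone (I : SimplexCategory ⥤ C) (n : SimplexCategory) :
    Cocone (colatchingDiagram I n) where
  pt := I.obj n
  ι :=
    { app := fun δ => I.map δ.obj.hom
      naturality := fun δ ε φ => by
        have h : I.map φ.hom.left ≫ I.map ε.obj.hom = I.map δ.obj.hom := by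
          rw [← I.map_comp, Over.w]
        exact h.trans (Category.comp_id _).symm }

variable [HasFiniteColimits C]

/-- The latching map `L_n X ⟶ X_n` of a simplicial object, where
`L_n X = colim_{[n] ↠ [m], m < n} X_m`. -/
noncomputable def latchingMap (X : SimplexCategoryᵒᵖ ⥤ C) (n : SimplexCategory) :
    colimit (latchingDiagram X n) ⟶ X.obj (op n) :=
  colimit.desc (latchingDiagram X n) (latchingCocone X n)

/-- The latching map `L^n I ⟶ I^n` of a cosimplicial object, where
`L^n I = colim_{[m] ↣ [n], m < n} I^m`. -/
noncomputable def colatchingMap (I : SimplexCategory ⥤ C) (n : SimplexCategory) :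
    colimit (colatchingDiagram I n) ⟶ I.obj n :=
  colimit.desc (colatchingDiagram I n) (colatchingCocone I n)

end Reedy

/-- A simplicial object is Reedy cofibrant if all its latching maps are cofibrations. -/
def IsReedyCofibrantSimplicial {C : Type u} [Category.{v} C] [ModelCategory C]
    (X : SimplexCategoryᵒᵖ ⥤ C) : Prop :=
  ∀ n : SimplexCategory, Cofibration (Reedy.latchingMap X n)

/-- A cosimplicial object is Reedy cofibrant if all its latching maps are cofibrations. -/
def IsReedyCofibrantCosimplicial {C : Type u} [Category.{v} C] [ModelCategory C]
    (I : SimplexCategory ⥤ C) : Prop :=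
  ∀ n : SimplexCategory, Cofibration (Reedy.colatchingMap I n)

/-!
Everything is deduced from `Reedy.weakEquivalence_coend`, which concerns a bifunctor `T` of model
categories that is a left adjoint in each variable and satisfies the pushout-product axiom.

The coend of `T (X_k, I^k)` is the sequential colimit of its skeleta, the coends over `k < n`. As
maps in the simplex category factor as a surjection followed by an injection, the next skeleton
arises from the `n`-th one by attaching `T (X_n, I^n)` along the pushout-product of the latching
maps `L_n X ⟶ X_n` and `L^n I ⟶ I^n` (`Reedy.PartialCoend.exists_isPushout`). By the
pushout-product axiom this is a pushout along a cofibration. The gluing lemma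
(`weakEquivalence_of_isPushout`) then shows inductively that weak equivalences of Reedy cofibrant
objects induce weak equivalences of skeleta, and its sequential analogue
(`weakEquivalence_of_isColimit_nat`) yields the weak equivalence of coends.

The induction needs that the maps of latching objects `L_n X ⟶ L_n Y` and `L^n I ⟶ L^n J` are weak
equivalences between cofibrant objects. A latching object is a colimit over morphisms of a direct
category (surjections out of, or injections into, `[n]`). Colimits over smaller classes of such
morphisms are built from each other by pushouts along latching maps of lower degree
(`Reedy.IsDirect.exists_isPushout`), so the gluing lemma applies again
(`Reedy.IsDirect.preservesWeakEquivalence`). By Ken Brown's lemma, `T` preserves weak equivalences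
between cofibrant objects in each variable, and by the gluing lemma the source of the
pushout-product map is homotopy invariant.

Neither the gluing lemma nor its sequential analogue presupposes properness. Both are proved by
extending a Brown factorization of a weak equivalence between cofibrant objects (a cofibration
followed by a retraction of a trivial cofibration) along cofibrations
(`CofibrantBrownFactorization.exists_extension`).

Latching objects and partial coends are handled through their universal properties,
`Reedy.ArrowColimit` and `Reedy.PartialCoend`, which are stated in terms of morphisms of the
indexing category rather than objects of full subcategories of slices. For the
tensor, the adjoint in the first variable is the cotensor and that in the second variable is the
enriched hom.
-/

/-! ### Gluing weak equivalences between cofibrant objects -/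

namespace HomotopicalAlgebra

section

variable {C : Type u} [Category.{v} C] [ModelCategory C]

/-- A commutative square `u ≫ i' = i ≫ t` is a relative trivial cofibration, from the arrow `u`
to the arrow `t`, if the induced map from the pushout of `u` and `i` is a trivial cofibration. -/
def IsRelTrivialCofibration {A A' Z Z' : C} (u : A ⟶ A') (i : A ⟶ Z) (i' : A' ⟶ Z')
    (t : Z ⟶ Z') : Prop :=
  ∃ w : u ≫ i' = i ≫ t, trivialCofibrations C (pushout.desc i' t w)

lemma IsRelTrivialCofibration.exists_lift {A A' Z Z' : C} {u : A ⟶ A'} {i : A ⟶ Z}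
    {i' : A' ⟶ Z'} {t : Z ⟶ Z'} (h : IsRelTrivialCofibration u i i' t) {E B : C} (p : E ⟶ B)
    [Fibration p] (a : A' ⟶ E) (z : Z ⟶ E) (b : Z' ⟶ B) (haz : u ≫ a = i ≫ z)
    (hab : a ≫ p = i' ≫ b) (hzb : z ≫ p = t ≫ b) :
    ∃ l : Z' ⟶ E, i' ≫ l = a ∧ t ≫ l = z ∧ l ≫ p = b := by
  obtain ⟨w, hw⟩ := h
  obtain ⟨_, _⟩ := (mem_trivialCofibrations_iff _).mp hw
  have sq : CommSq (pushout.desc a z haz) (pushout.desc i' t w) p b :=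
    ⟨by
      ext <;> simp only [pushout.inl_desc_assoc, pushout.inr_desc_assoc, hab, hzb]⟩
  refine ⟨sq.lift, ?_, ?_, sq.fac_right⟩
  · simpa only [pushout.inl_desc, pushout.inl_desc_assoc] using pushout.inl u i ≫= sq.fac_left
  · simpa only [pushout.inr_desc, pushout.inr_desc_assoc] using pushout.inr u i ≫= sq.fac_left

lemma IsRelTrivialCofibration.of_cofibration {A A' Z Z' : C} {u : A ⟶ A'} {i : A ⟶ Z}
    {i' : A' ⟶ Z'} {t : Z ⟶ Z'} (w : u ≫ i' = i ≫ t) [Cofibration i] [WeakEquivalence i]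
    [WeakEquivalence i'] (h : Cofibration (pushout.desc i' t w)) :
    IsRelTrivialCofibration u i i' t := by
  refine ⟨w, (mem_trivialCofibrations_iff _).mpr ⟨h, ?_⟩⟩
  exact weakEquivalence_of_precomp_of_fac (pushout.inl_desc i' t w)

/-- Brown factorizations of weak equivalences extend along cofibrations: the cylinder of `f'` is
obtained by factoring the map to `B'` from the union of `A'`, `B'` and the cylinder of `f`. -/
lemma CofibrantBrownFactorization.exists_extension {A A' B B' : C} {u : A ⟶ A'} {v : B ⟶ B'}
    [Cofibration u] [Cofibration v] {f : A ⟶ B} {f' : A' ⟶ B'} [WeakEquivalence f]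
    [WeakEquivalence f'] (w : u ≫ f' = f ≫ v) (h : CofibrantBrownFactorization f) :
    ∃ (h' : CofibrantBrownFactorization f') (t : h.Z ⟶ h'.Z),
      t ≫ h'.p = h.p ≫ v ∧ IsRelTrivialCofibration u h.i h'.i t ∧
        IsRelTrivialCofibration v h.s h'.s t := by
  have : Cofibration h.i := by simpa only [cofibration_iff] using h.hi
  let p₁ : pushout u h.i ⟶ B' := pushout.desc f' (h.p ≫ v) (by simp [w])
  let p₂ : pushout v (h.s ≫ pushout.inr u h.i) ⟶ B' :=
    pushout.desc (𝟙 B') p₁ (by simp [p₁, pushout.inr_desc])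
  let d := MorphismProperty.factorizationData (cofibrations C) (trivialFibrations C) p₂
  let s' : B' ⟶ d.Z := pushout.inl _ _ ≫ d.i
  let z₁ : pushout u h.i ⟶ d.Z := pushout.inr _ _ ≫ d.i
  let i' : A' ⟶ d.Z := pushout.inl u h.i ≫ z₁
  let t : h.Z ⟶ d.Z := pushout.inr u h.i ≫ z₁
  have hz₁ : z₁ ≫ d.p = p₁ := by simp [z₁, p₂, pushout.inr_desc]
  have hi' : i' ≫ d.p = f' := by simp only [i', Category.assoc, hz₁, p₁, pushout.inl_desc]
  have hs' : s' ≫ d.p = 𝟙 B' := by simp [s', p₂, pushout.inl_desc]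
  have hci : Cofibration i' := by dsimp only [i', z₁]; infer_instance
  let h' : CofibrantBrownFactorization f' :=
    { Z := d.Z
      i := i'
      p := d.p
      fac := hi'
      hi := (cofibration_iff _).mp hci
      hp := d.hp
      s := s'
      s_p := hs'
      cofibration_s := by dsimp only [s']; infer_instance }
  have hwi : WeakEquivalence i' := weakEquivalence_of_postcomp_of_fac hi'
  have hws : WeakEquivalence s' := weakEquivalence_of_postcomp_of_fac hs'
  have wi : u ≫ i' = h.i ≫ t := by
    dsimp only [i', t]
    rw [pushout.condition_assoc]
  have ws : v ≫ s' = h.s ≫ t := by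
    dsimp only [s', t, z₁]
    rw [pushout.condition_assoc, Category.assoc]
  refine ⟨h', t, ?_, ?_, ?_⟩
  · change t ≫ d.p = _
    simp only [t, Category.assoc, hz₁, p₁, pushout.inr_desc]
  · refine IsRelTrivialCofibration.of_cofibration wi ?_
    have : pushout.desc i' t wi = z₁ := by
      ext <;> simp only [i', t, pushout.inl_desc, pushout.inr_desc]
    rw [this]
    dsimp only [z₁]
    infer_instance
  · refine IsRelTrivialCofibration.of_cofibration ws ?_
    -- the map from `B' ∪_B Z` to the union is a cobase change of `Z ⟶ A' ∪_A Z`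
    have comm : v ≫ pushout.inl v (h.s ≫ pushout.inr u h.i) =
        h.s ≫ pushout.inr u h.i ≫ pushout.inr v (h.s ≫ pushout.inr u h.i) := by
      simp [pushout.condition]
    have sq : IsPushout (pushout.inr u h.i) (pushout.inr v h.s)
        (pushout.inr v (h.s ≫ pushout.inr u h.i)) (pushout.desc _ _ comm) :=
      IsPushout.of_left (by
        simpa only [pushout.inl_desc] using
          (IsPushout.of_hasPushout v (h.s ≫ pushout.inr u h.i)).flip)
        (by rw [pushout.inr_desc]) (IsPushout.of_hasPushout v h.s).flip
    have hc : Cofibration (pushout.desc _ _ comm) := by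
      rw [cofibration_iff]
      exact MorphismProperty.of_isPushout sq.flip (mem_cofibrations (pushout.inr u h.i))
    have : pushout.desc s' t ws = pushout.desc _ _ comm ≫ d.i := by
      ext <;>
        simp only [s', t, z₁, pushout.inl_desc, pushout.inr_desc, pushout.inl_desc_assoc,
        pushout.inr_desc_assoc, Category.assoc]
    rw [this]
    infer_instance

/-- A map of pushout squares is a trivial cofibration if it is one at the corner `b` and relatively
so along `g`: lifting problems are solved on `b'` and then on `c'`. -/
lemma trivialCofibration_of_isPushout {a b c d a' b' c' d' : C} {f : a ⟶ b} {g : a ⟶ c}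
    {k : b ⟶ d} {l : c ⟶ d} (sq : IsPushout f g k l) {f' : a' ⟶ b'} {g' : a' ⟶ c'}
    {k' : b' ⟶ d'} {l' : c' ⟶ d'} (sq' : IsPushout f' g' k' l') {α : a ⟶ a'} {β : b ⟶ b'}
    {γ : c ⟶ c'} {δ : d ⟶ d'} (hf : f ≫ β = α ≫ f') (hk : k ≫ δ = β ≫ k')
    (hl : l ≫ δ = γ ≫ l') (hβ : trivialCofibrations C β)
    (hγ : IsRelTrivialCofibration g α γ g') : trivialCofibrations C δ := by
  rw [← fibrations_llp]
  intro E B p hp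
  rw [← fibration_iff] at hp
  obtain ⟨_, _⟩ := (mem_trivialCofibrations_iff _).mp hβ
  refine ⟨fun {e y} sqp => ?_⟩
  have sqb : CommSq (k ≫ e) β p (k' ≫ y) := ⟨by
    rw [Category.assoc, sqp.w, reassoc_of% hk]⟩
  obtain ⟨l₁, h₁, h₂, h₃⟩ := hγ.exists_lift p (l ≫ e) (f' ≫ sqb.lift) (l' ≫ y)
    (by rw [← reassoc_of% hf, sqb.fac_left, reassoc_of% sq.w])
    (by rw [Category.assoc, sqp.w, reassoc_of% hl])
    (by rw [Category.assoc, sqb.fac_right, reassoc_of% sq'.w])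
  refine ⟨⟨⟨sq'.desc sqb.lift l₁ h₂.symm, ?_, ?_⟩⟩⟩
  · apply sq.hom_ext
    · rw [reassoc_of% hk, sq'.inl_desc, sqb.fac_left]
    · rw [reassoc_of% hl, sq'.inr_desc, h₁]
  · apply sq'.hom_ext
    · rw [sq'.inl_desc_assoc, sqb.fac_right]
    · rw [sq'.inr_desc_assoc, h₃]

/-- The gluing lemma: a weak equivalence of pushout squares of cofibrant objects, along
cofibrations `g` and `g'`. The map of spans is factored as in Brown's lemma, with cylinders chosen
first on the corner `b`, then compatibly on `a`, and finally on `c` relatively to `a`. -/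
lemma weakEquivalence_of_isPushout {a b c d a' b' c' d' : C} {f : a ⟶ b} {g : a ⟶ c}
    {k : b ⟶ d} {l : c ⟶ d} (sq : IsPushout f g k l) {f' : a' ⟶ b'} {g' : a' ⟶ c'}
    {k' : b' ⟶ d'} {l' : c' ⟶ d'} (sq' : IsPushout f' g' k' l') {α : a ⟶ a'} {β : b ⟶ b'}
    {γ : c ⟶ c'} {δ : d ⟶ d'} (hf : f ≫ β = α ≫ f') (hg : g ≫ γ = α ≫ g')
    (hk : k ≫ δ = β ≫ k') (hl : l ≫ δ = γ ≫ l')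
    [IsCofibrant a] [IsCofibrant b] [IsCofibrant a'] [IsCofibrant b']
    [Cofibration g] [Cofibration g'] [WeakEquivalence α] [WeakEquivalence β]
    [WeakEquivalence γ] : WeakEquivalence δ := by
  obtain ⟨hb⟩ : Nonempty (CofibrantBrownFactorization β) := inferInstance
  have : Cofibration hb.i := by simpa only [cofibration_iff] using hb.hi
  have : Fibration hb.p := by simpa only [fibration_iff] using hb.hp.1
  have : WeakEquivalence hb.p := by simpa only [weakEquivalence_iff] using hb.hp.2
  -- factoring through `pullback f' hb.p` provides the map `z` from the cylinder on `a` to the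
  -- one on `b`
  let φ : a ⨿ a' ⟶ pullback f' hb.p :=
    coprod.desc (pullback.lift α (f ≫ hb.i) (by simp [hf]))
      (pullback.lift (𝟙 a') (f' ≫ hb.s) (by simp))
  let da := MorphismProperty.factorizationData (cofibrations C) (trivialFibrations C) φ
  have hi₁ : (coprod.inl ≫ da.i) ≫ da.p = pullback.lift α (f ≫ hb.i) (by simp [hf]) := by
    rw [Category.assoc, da.fac, coprod.inl_desc]
  have hs₁ : (coprod.inr ≫ da.i) ≫ da.p = pullback.lift (𝟙 a') (f' ≫ hb.s) (by simp) := by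
    rw [Category.assoc, da.fac, coprod.inr_desc]
  let ha : CofibrantBrownFactorization α :=
    { Z := da.Z
      i := coprod.inl ≫ da.i
      p := da.p ≫ pullback.fst _ _
      fac := by rw [← Category.assoc, hi₁, pullback.lift_fst]
      hi := by
        rw [← cofibration_iff]
        infer_instance
      hp := by
        rw [mem_trivialFibrations_iff]
        constructor <;> infer_instance
      s := coprod.inr ≫ da.i
      s_p := by rw [← Category.assoc, hs₁, pullback.lift_fst] }
  let z : ha.Z ⟶ hb.Z := da.p ≫ pullback.snd _ _
  have hz₁ : f ≫ hb.i = ha.i ≫ z := by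
    simp only [ha, z]
    rw [← Category.assoc, hi₁, pullback.lift_snd]
  have hz₂ : f' ≫ hb.s = ha.s ≫ z := by
    simp only [ha, z]
    rw [← Category.assoc, hs₁, pullback.lift_snd]
  have hz₃ : z ≫ hb.p = ha.p ≫ f' := by
    simp only [ha, z, Category.assoc, pullback.condition]
  obtain ⟨hc, t, ht, h₁, h₂⟩ := ha.exists_extension hg
  obtain ⟨w₁, -⟩ := id h₁
  obtain ⟨w₂, -⟩ := id h₂
  let id' : d ⟶ pushout z t := sq.desc (hb.i ≫ pushout.inl _ _) (hc.i ≫ pushout.inr _ _) (by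
    rw [reassoc_of% hz₁, reassoc_of% w₁, pushout.condition])
  let sd : d' ⟶ pushout z t := sq'.desc (hb.s ≫ pushout.inl _ _) (hc.s ≫ pushout.inr _ _) (by
    rw [reassoc_of% hz₂, reassoc_of% w₂, pushout.condition])
  let pd : pushout z t ⟶ d' := pushout.desc (hb.p ≫ k') (hc.p ≫ l') (by
    rw [reassoc_of% hz₃, reassoc_of% ht, sq'.w])
  have hid : trivialCofibrations C id' :=
    trivialCofibration_of_isPushout sq (IsPushout.of_hasPushout z t) hz₁ (by simp [id'])
      (by simp [id']) (mem_trivialCofibrations _) h₁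
  have hsd : trivialCofibrations C sd :=
    trivialCofibration_of_isPushout sq' (IsPushout.of_hasPushout z t) hz₂ (by simp [sd])
      (by simp [sd]) (mem_trivialCofibrations _) h₂
  have hsp : sd ≫ pd = 𝟙 d' := by
    apply sq'.hom_ext <;> simp [sd, pd, pushout.inl_desc, pushout.inr_desc]
  have hip : id' ≫ pd = δ := by
    apply sq.hom_ext
    · simp [id', pd, hk, pushout.inl_desc]
    · simp [id', pd, hl, pushout.inr_desc]
  have := ((mem_trivialCofibrations_iff _).mp hid).2
  have := ((mem_trivialCofibrations_iff _).mp hsd).2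
  have : WeakEquivalence pd := weakEquivalence_of_precomp_of_fac hsp
  rw [← hip]
  infer_instance

/-- A map of sequential colimits is a trivial cofibration if it is one at the start and relatively
so along each step: lifts are extended recursively. -/
lemma trivialCofibration_of_isColimit_nat {F G : ℕ ⥤ C} (τ : F ⟶ G) {cF : Cocone F}
    {cG : Cocone G} (hF : IsColimit cF) (hG : IsColimit cG) {φ : cF.pt ⟶ cG.pt}
    (hφ : ∀ n, cF.ι.app n ≫ φ = τ.app n ≫ cG.ι.app n)
    (h₀ : trivialCofibrations C (τ.app 0))
    (h : ∀ n, IsRelTrivialCofibration (F.map (homOfLE n.le_succ)) (τ.app n) (τ.app (n + 1))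
      (G.map (homOfLE n.le_succ))) : trivialCofibrations C φ := by
  rw [← fibrations_llp]
  intro E B p hp
  rw [← fibration_iff] at hp
  obtain ⟨_, _⟩ := (mem_trivialCofibrations_iff _).mp h₀
  refine ⟨fun {e y} sq => ?_⟩
  let L (n : ℕ) : Type _ := { l : G.obj n ⟶ E //
    τ.app n ≫ l = cF.ι.app n ≫ e ∧ l ≫ p = cG.ι.app n ≫ y }
  have base : Nonempty (L 0) := by
    have sq₀ : CommSq (cF.ι.app 0 ≫ e) (τ.app 0) p (cG.ι.app 0 ≫ y) := ⟨by
      rw [Category.assoc, sq.w, reassoc_of% hφ]⟩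
    exact ⟨sq₀.lift, sq₀.fac_left, sq₀.fac_right⟩
  have step (n : ℕ) (l : L n) : ∃ l' : L (n + 1), G.map (homOfLE n.le_succ) ≫ l'.1 = l.1 := by
    obtain ⟨l', h₁, h₂, h₃⟩ := (h n).exists_lift p (cF.ι.app (n + 1) ≫ e) l.1
      (cG.ι.app (n + 1) ≫ y) (by rw [cF.w_assoc, l.2.1])
      (by rw [Category.assoc, sq.w, reassoc_of% hφ]) (by rw [cG.w_assoc, l.2.2])
    exact ⟨⟨l', h₁, h₃⟩, h₂⟩
  choose next hnext using step
  let l (n : ℕ) : L n := Nat.rec base.some next n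
  have hl (n : ℕ) : G.map (homOfLE n.le_succ) ≫ (l (n + 1)).1 = (l n).1 := hnext n (l n)
  let c : Cocone G := ⟨E, NatTrans.ofSequence (fun n => (l n).1) (fun n => by simp [hl])⟩
  have hc (n : ℕ) : cG.ι.app n ≫ hG.desc c = (l n).1 := hG.fac c n
  refine ⟨⟨⟨hG.desc c, ?_, ?_⟩⟩⟩
  · refine hF.hom_ext fun n => ?_
    rw [reassoc_of% hφ, hc, (l n).2.1]
  · refine hG.hom_ext fun n => ?_
    rw [reassoc_of% hc, (l n).2.2]

/-- Colimits of sequences of cofibrations between cofibrant objects preserve weak equivalences.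
Brown factorizations of the maps of the sequence are extended step by step. -/
lemma weakEquivalence_of_isColimit_nat [HasColimitsOfShape ℕ C] {F G : ℕ ⥤ C} (τ : F ⟶ G)
    {cF : Cocone F} {cG : Cocone G} (hF : IsColimit cF) (hG : IsColimit cG)
    {φ : cF.pt ⟶ cG.pt} (hφ : ∀ n, cF.ι.app n ≫ φ = τ.app n ≫ cG.ι.app n)
    [IsCofibrant (F.obj 0)] [IsCofibrant (G.obj 0)]
    (hF' : ∀ n, Cofibration (F.map (homOfLE (Nat.le_succ n))))
    (hG' : ∀ n, Cofibration (G.map (homOfLE (Nat.le_succ n))))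
    (hτ : ∀ n, WeakEquivalence (τ.app n)) : WeakEquivalence φ := by
  obtain ⟨h₀⟩ : Nonempty (CofibrantBrownFactorization (τ.app 0)) := inferInstance
  have step (n : ℕ) (h : CofibrantBrownFactorization (τ.app n)) :=
    h.exists_extension (τ.naturality (homOfLE n.le_succ))
  choose next t h₁ h₂ h₃ using step
  let H (n : ℕ) : CofibrantBrownFactorization (τ.app n) := Nat.rec h₀ next n
  let Z : ℕ ⥤ C := Functor.ofSequence (X := fun n => (H n).Z) (fun n => t n (H n))
  have hZ (n : ℕ) : Z.map (homOfLE n.le_succ) = t n (H n) :=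
    Functor.ofSequence_map_homOfLE_succ _ n
  let i : F ⟶ Z := NatTrans.ofSequence (fun n => (H n).i) (fun n => by
    rw [hZ]
    exact (h₂ n (H n)).choose)
  let s : G ⟶ Z := NatTrans.ofSequence (fun n => (H n).s) (fun n => by
    rw [hZ]
    exact (h₃ n (H n)).choose)
  let p : Z ⟶ G := NatTrans.ofSequence (fun n => (H n).p) (fun n => by
    rw [hZ]
    exact h₁ n (H n))
  have hip : i ≫ p = τ := by
    ext n
    exact (H n).fac
  have hsp : s ≫ p = 𝟙 G := by
    ext n
    exact (H n).s_p
  obtain ⟨cZ, ⟨hcZ⟩⟩ : ∃ c : Cocone Z, Nonempty (IsColimit c) := ⟨_, ⟨colimit.isColimit Z⟩⟩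
  have : Cofibration h₀.i := by simpa only [cofibration_iff] using h₀.hi
  have hi : trivialCofibrations C (hF.map cZ i) :=
    trivialCofibration_of_isColimit_nat i hF hcZ (fun n => hF.ι_map _ _ _)
      (mem_trivialCofibrations h₀.i) (fun n => by
        rw [hZ]
        exact h₂ n (H n))
  have hs : trivialCofibrations C (hG.map cZ s) :=
    trivialCofibration_of_isColimit_nat s hG hcZ (fun n => hG.ι_map _ _ _)
      (mem_trivialCofibrations h₀.s) (fun n => by
        rw [hZ]
        exact h₃ n (H n))
  have := ((mem_trivialCofibrations_iff _).mp hi).2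
  have := ((mem_trivialCofibrations_iff _).mp hs).2
  let q := hcZ.map cG p
  have hq : hG.map cZ s ≫ q = 𝟙 _ := hG.hom_ext fun n => by
    have := NatTrans.congr_app hsp n
    simp only [NatTrans.comp_app, NatTrans.id_app] at this
    simp [q, IsColimit.ι_map_assoc, reassoc_of% this]
  have hq' : hF.map cZ i ≫ q = φ := hF.hom_ext fun n => by
    have := NatTrans.congr_app hip n
    simp only [NatTrans.comp_app] at this
    simp [q, IsColimit.ι_map_assoc, reassoc_of% this, hφ]
  have : WeakEquivalence q := weakEquivalence_of_precomp_of_fac hq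
  rw [← hq']
  infer_instance

/-- Ken Brown's lemma. -/
lemma weakEquivalence_map_of_trivialCofibrations {D : Type u'} [Category.{v'} D]
    [CategoryWithWeakEquivalences D] [(weakEquivalences D).HasTwoOutOfThreeProperty]
    [(weakEquivalences D).ContainsIdentities]
    (G : C ⥤ D) (hG : ∀ ⦃A B : C⦄ (i : A ⟶ B) [IsCofibrant A] [Cofibration i]
      [WeakEquivalence i], WeakEquivalence (G.map i))
    {A B : C} (f : A ⟶ B) [IsCofibrant A] [IsCofibrant B] [WeakEquivalence f] :
    WeakEquivalence (G.map f) := by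
  obtain ⟨h⟩ : Nonempty (CofibrantBrownFactorization f) := inferInstance
  have : Cofibration h.i := by simpa only [cofibration_iff] using h.hi
  have := hG h.i
  have := hG h.s
  have hs : G.map h.s ≫ G.map h.p = 𝟙 _ := by rw [← G.map_comp, h.s_p, G.map_id]
  have : WeakEquivalence (G.map h.p) := weakEquivalence_of_precomp_of_fac hs
  rw [← h.fac, G.map_comp]
  infer_instance

end

end HomotopicalAlgebra

/-! ### Latching objects over direct categories -/

namespace Reedy

/-- `IsDirect W deg` means that the morphisms of `W` are the morphisms of a direct category: they
do not lower the degree, and only identities preserve it. Moreover `W` is closed under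
composition, and contains `f` if it contains `f ≫ g`. -/
structure IsDirect {C : Type} [SmallCategory C] (W : MorphismProperty C) (deg : C → ℕ) :
    Prop where
  comp {a b c : C} {f : a ⟶ b} {g : b ⟶ c} : W f → W g → W (f ≫ g)
  of_comp {a b c : C} (f : a ⟶ b) (g : b ⟶ c) : W (f ≫ g) → W f
  le {a b : C} {f : a ⟶ b} : W f → deg a ≤ deg b
  exists_eqToHom {a b : C} {f : a ⟶ b} : W f → deg b ≤ deg a → ∃ h : a = b, f = eqToHom h

/-- The morphisms of `W` to `c` from objects of smaller degree. -/
def latchingArrows {C : Type} [SmallCategory C] (W : MorphismProperty C) (deg : C → ℕ) (c : C)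
    ⦃b : C⦄ (v : b ⟶ c) : Prop :=
  W v ∧ deg b < deg c

/-- A colimit of the functor `X` over the full subcategory of `Over d` given by a class `P` of
morphisms to `d`, described by its universal property in terms of these morphisms. -/
structure ArrowColimit {C : Type} [SmallCategory C] {M : Type u} [Category.{v} M] (X : C ⥤ M)
    {d : C} (P : ∀ ⦃c : C⦄, (c ⟶ d) → Prop) where
  /-- the colimit -/
  pt : M
  /-- the inclusions -/
  ι {c : C} (p : c ⟶ d) (hp : P p) : X.obj c ⟶ pt
  w {b c : C} (v : b ⟶ c) (p : c ⟶ d) (hp : P p) (hvp : P (v ≫ p)) :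
    X.map v ≫ ι p hp = ι (v ≫ p) hvp
  exists_desc {Z : M} (ψ : ∀ {c : C} (p : c ⟶ d), P p → (X.obj c ⟶ Z))
    (hψ : ∀ {b c : C} (v : b ⟶ c) (p : c ⟶ d) (hp : P p) (hvp : P (v ≫ p)),
      X.map v ≫ ψ p hp = ψ (v ≫ p) hvp) :
    ∃ φ : pt ⟶ Z, ∀ {c : C} (p : c ⟶ d) (hp : P p), ι p hp ≫ φ = ψ p hp
  hom_ext {Z : M} {φ φ' : pt ⟶ Z} (h : ∀ {c : C} (p : c ⟶ d) (hp : P p),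
    ι p hp ≫ φ = ι p hp ≫ φ') : φ = φ'

/-- `X` is Reedy cofibrant along `W`: for all objects `c`, the map to `X.obj c` from the latching
object is a cofibration. The latching object is any colimit of `X` over the morphisms of `W` to
`c` from objects of smaller degree. -/
def IsLatchingCofibrant {C : Type} [SmallCategory C] (W : MorphismProperty C) (deg : C → ℕ)
    {M : Type u} [Category.{v} M] [CategoryWithCofibrations M] (X : C ⥤ M) : Prop :=
  ∀ (c : C) (L : ArrowColimit X (latchingArrows W deg c)) (g : L.pt ⟶ X.obj c),
    (∀ {b : C} (v : b ⟶ c) (hv : latchingArrows W deg c v), L.ι v hv ≫ g = X.map v) →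
      Cofibration g

section

variable {C : Type} [SmallCategory C] {M : Type u} [Category.{v} M]

/-- The colimit over a full subcategory of `Over d` as an `ArrowColimit`. -/
def ArrowColimit.ofIsColimit (X : C ⥤ M) {d : C} (P : ∀ ⦃c : C⦄, (c ⟶ d) → Prop)
    {s : Cocone ((ObjectProperty.ι (fun a : Over d => P a.hom) ⋙ Over.forget d) ⋙ X)}
    (hs : IsColimit s) : ArrowColimit X P where
  pt := s.pt
  ι p hp := s.ι.app ⟨Over.mk p, hp⟩
  w v p hp hvp := s.w (j' := ⟨Over.mk (v ≫ p), hvp⟩) (j := ⟨Over.mk p, hp⟩)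
    (ObjectProperty.homMk (Over.homMk (U := Over.mk (v ≫ p)) (V := Over.mk p) v))
  exists_desc {Z} ψ hψ := by
    let t : Cocone ((ObjectProperty.ι (fun a : Over d => P a.hom) ⋙ Over.forget d) ⋙ X) :=
      { pt := Z
        ι :=
          { app := fun a => ψ a.obj.hom a.property
            naturality := fun a b φ => by
              have key : ∀ (p : a.obj.left ⟶ d) (hp : P p), φ.hom.left ≫ b.obj.hom = p →
                  X.map φ.hom.left ≫ ψ b.obj.hom b.property = ψ p hp := by
                rintro p hp rfl
                exact hψ _ _ _ _
              exact (key _ a.property (Over.w φ.hom)).trans (Category.comp_id _).symm } }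
    exact ⟨hs.desc t, fun p hp => hs.fac t ⟨Over.mk p, hp⟩⟩
  hom_ext h := hs.hom_ext fun a => h a.obj.hom a.property

lemma nonempty_arrowColimit [∀ a b : C, Finite (a ⟶ b)] [HasFiniteColimits M] (X : C ⥤ M) {d : C}
    (P : ∀ ⦃c : C⦄, (c ⟶ d) → Prop) (hP : {a : Over d | P a.hom}.Finite) :
    Nonempty (ArrowColimit X P) := by
  let Q : ObjectProperty (Over d) := fun a => P a.hom
  have : Finite {a // Q a} := hP
  have : Finite Q.FullSubcategory :=
    Finite.of_surjective (fun a : {a // Q a} => ⟨a.1, a.2⟩) (fun a => ⟨⟨a.1, a.2⟩, rfl⟩)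
  have (a b : Q.FullSubcategory) : Finite (a ⟶ b) :=
    Finite.of_injective (fun f => f.hom.left) (by
      intro f g h
      ext1
      exact Over.OverMorphism.ext h)
  have : FinCategory Q.FullSubcategory :=
    { fintypeObj := Fintype.ofFinite _
      fintypeHom := fun _ _ => Fintype.ofFinite _ }
  exact ⟨.ofIsColimit X P (colimit.isColimit _)⟩

namespace ArrowColimit

variable {X Y : C ⥤ M} {d : C} {P : ∀ ⦃c : C⦄, (c ⟶ d) → Prop}

lemma w' (K : ArrowColimit X P) {b c : C} (v : b ⟶ c) (p : c ⟶ d) (hp : P p) (q : b ⟶ d)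
    (hq : P q) (h : v ≫ p = q) : X.map v ≫ K.ι p hp = K.ι q hq := by
  subst h
  exact K.w v p hp hq

lemma exists_map (K : ArrowColimit X P) (K' : ArrowColimit Y P) (τ : X ⟶ Y) :
    ∃ φ : K.pt ⟶ K'.pt, ∀ {c : C} (p : c ⟶ d) (hp : P p),
      K.ι p hp ≫ φ = τ.app c ≫ K'.ι p hp :=
  K.exists_desc (fun {c} p hp => τ.app c ≫ K'.ι p hp) (fun v p hp hvp => by
    rw [τ.naturality_assoc, K'.w v p hp hvp])

/-- The empty colimit is initial. -/
lemma isCofibrant_of_isEmpty [ModelCategory M]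
    (hP : ∀ ⦃c : C⦄ (p : c ⟶ d), ¬ P p) (K : ArrowColimit X P) : IsCofibrant K.pt := by
  have h : IsInitial K.pt := IsInitial.ofUniqueHom
    (fun Z => (K.exists_desc (fun p hp => (hP p hp).elim) (fun v p hp => (hP p hp).elim)).choose)
    (fun Z m => K.hom_ext fun p hp => (hP p hp).elim)
  exact (isCofibrant_iff_of_isInitial (𝟙 K.pt) h).mpr inferInstance

/-- The map to `X.obj d` from the colimit of `X` over morphisms to `d`. -/
noncomputable def toObj (K : ArrowColimit X P) : K.pt ⟶ X.obj d :=
  (K.exists_desc (fun p _ => X.map p) (fun v p _ _ => (X.map_comp v p).symm)).choose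

lemma ι_toObj (K : ArrowColimit X P) {c : C} (p : c ⟶ d) (hp : P p) :
    K.ι p hp ≫ K.toObj = X.map p :=
  (K.exists_desc (fun p _ => X.map p) (fun v p _ _ => (X.map_comp v p).symm)).choose_spec p hp

end ArrowColimit

variable {W : MorphismProperty C} {deg : C → ℕ}

/-- Removing from `P` a morphism `u` whose source has maximal degree presents the colimit over `P`
as a pushout along the latching map at the source of `u`. -/
lemma IsDirect.exists_isPushout (hW : IsDirect W deg) {X : C ⥤ M} {d : C}
    {P : ∀ ⦃c : C⦄, (c ⟶ d) → Prop} (hP : ∀ ⦃c⦄ (p : c ⟶ d), P p → W p)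
    (hP' : ∀ ⦃b c : C⦄ (v : b ⟶ c) (p : c ⟶ d), W v → P p → P (v ≫ p))
    {a : C} {u : a ⟶ d} (hu : P u) (hmax : ∀ ⦃c⦄ (p : c ⟶ d), P p → deg c ≤ deg a)
    {P' : ∀ ⦃c : C⦄, (c ⟶ d) → Prop}
    (hPP' : ∀ ⦃c⦄ (p : c ⟶ d), P' p ↔ P p ∧ ¬ ∃ h : c = a, p = eqToHom h ≫ u)
    (L : ArrowColimit X (latchingArrows W deg a)) (K' : ArrowColimit X P')
    (K : ArrowColimit X P) :
    ∃ (f : L.pt ⟶ K'.pt) (k : K'.pt ⟶ K.pt),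
      (∀ {b} (v : b ⟶ a) (hv : latchingArrows W deg a v) (hv' : P' (v ≫ u)),
        L.ι v hv ≫ f = K'.ι (v ≫ u) hv') ∧
      (∀ {c} (p : c ⟶ d) (hp : P' p) (hp' : P p), K'.ι p hp ≫ k = K.ι p hp') ∧
      IsPushout f L.toObj k (K.ι u hu) := by
  have hLP' {b : C} (v : b ⟶ a) (hv : latchingArrows W deg a v) : P' (v ≫ u) := by
    refine (hPP' _).mpr ⟨hP' v u hv.1 hu, ?_⟩
    rintro ⟨rfl, -⟩
    exact hv.2.ne rfl
  obtain ⟨f, hf⟩ := L.exists_desc (fun v hv => K'.ι (v ≫ u) (hLP' v hv)) (fun v p hp hvp =>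
    K'.w' _ _ _ _ _ (Category.assoc _ _ _).symm)
  obtain ⟨k, hk⟩ := K'.exists_desc (fun p hp => K.ι p ((hPP' p).mp hp).1) (fun v p hp hvp =>
    K.w _ _ _ _)
  refine ⟨f, k, fun v hv _ => hf v hv, fun p hp _ => hk p hp, ?_⟩
  have w : f ≫ k = L.toObj ≫ K.ι u hu := L.hom_ext fun v hv => by
    rw [reassoc_of% (hf v hv), hk, ← Category.assoc, L.ι_toObj, K.w]
  have key (s : PushoutCocone f L.toObj) : ∃ φ : K.pt ⟶ s.pt, k ≫ φ = s.inl ∧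
      K.ι u hu ≫ φ = s.inr := by
    classical
    let ψ {c : C} (p : c ⟶ d) (hp : P p) : X.obj c ⟶ s.pt :=
      if h : ∃ h : c = a, p = eqToHom h ≫ u then X.map (eqToHom h.choose) ≫ s.inr
      else K'.ι p ((hPP' p).mpr ⟨hp, h⟩) ≫ s.inl
    have ψ_u : ψ u hu = s.inr := by
      have h : ∃ h : a = a, u = eqToHom h ≫ u := ⟨rfl, by simp⟩
      simp only [ψ, dif_pos h, eqToHom_refl, X.map_id, Category.id_comp]
    have ψ_P' {c : C} (p : c ⟶ d) (hp : P p) (hp' : P' p) : ψ p hp = K'.ι p hp' ≫ s.inl :=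
      dif_neg ((hPP' p).mp hp').2
    obtain ⟨φ, hφ⟩ := K.exists_desc ψ (by
      intro b c v p hp hvp
      have hv : W v := hW.of_comp v p (hP _ hvp)
      by_cases h₁ : ∃ h : c = a, p = eqToHom h ≫ u
      · obtain ⟨rfl, rfl⟩ := h₁
        simp only [eqToHom_refl, Category.id_comp] at hp hvp ⊢
        rw [ψ_u]
        by_cases h₂ : deg c ≤ deg b
        · obtain ⟨rfl, rfl⟩ := hW.exists_eqToHom hv h₂
          simp only [eqToHom_refl, Category.id_comp, X.map_id]
          exact ψ_u.symm
        · have hv' : latchingArrows W deg c v := ⟨hv, by lia⟩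
          rw [ψ_P' _ hvp (hLP' v hv'), ← hf v hv', Category.assoc, s.condition, ← Category.assoc,
            L.ι_toObj]
      · rw [ψ_P' p hp ((hPP' _).mpr ⟨hp, h₁⟩)]
        have h₂ : ¬ ∃ h : b = a, v ≫ p = eqToHom h ≫ u := by
          rintro ⟨rfl, h₂⟩
          obtain ⟨rfl, rfl⟩ := hW.exists_eqToHom hv (hmax _ hp)
          exact h₁ ⟨rfl, by simpa using h₂⟩
        rw [ψ_P' _ hvp ((hPP' _).mpr ⟨hvp, h₂⟩), ← Category.assoc, K'.w])
    refine ⟨φ, K'.hom_ext fun p hp => ?_, ?_⟩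
    · rw [reassoc_of% (hk p hp), hφ, ψ_P' p ((hPP' p).mp hp).1 hp]
    · rw [hφ, ψ_u]
  choose φ hφ₁ hφ₂ using key
  refine ⟨⟨w⟩, ⟨PushoutCocone.IsColimit.mk _ φ hφ₁ hφ₂ (fun s m h₁ h₂ => ?_)⟩⟩
  refine K.hom_ext fun p hp => ?_
  by_cases h : ∃ h : _ = a, p = eqToHom h ≫ u
  · obtain ⟨rfl, rfl⟩ := h
    simp only [eqToHom_refl, Category.id_comp] at hp ⊢
    rw [h₂, hφ₂]
  · have hp' := (hPP' p).mpr ⟨hp, h⟩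
    rw [← hk p hp', Category.assoc, Category.assoc, h₁, hφ₁]

end

section

variable {C : Type} [SmallCategory C] [∀ a b : C, Finite (a ⟶ b)]
  {W : MorphismProperty C} {deg : C → ℕ} {M : Type u} [Category.{v} M] [ModelCategory M]
  {X Y : C ⥤ M}

/-- The colimits of `X` and `Y` over the morphisms in `P` are cofibrant, and `τ : X ⟶ Y` induces a
weak equivalence between them. -/
structure PreservesWeakEquivalence (τ : X ⟶ Y) {d : C} (P : ∀ ⦃c : C⦄, (c ⟶ d) → Prop) :
    Prop where
  isCofibrant_left (K : ArrowColimit X P) : IsCofibrant K.pt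
  isCofibrant_right (K : ArrowColimit Y P) : IsCofibrant K.pt
  weakEquivalence (K : ArrowColimit X P) (K' : ArrowColimit Y P) (φ : K.pt ⟶ K'.pt)
    (hφ : ∀ {c : C} (p : c ⟶ d) (hp : P p), K.ι p hp ≫ φ = τ.app c ≫ K'.ι p hp) :
    WeakEquivalence φ

/-- If latching objects in degrees `< n` behave well, so do the colimits over all finite classes `P`
of morphisms of `W` from objects of degree `< n`, provided `P` is closed under precomposition with
`W`. The proof is by induction on the number of elements of `P`, removing one whose source has
maximal degree. -/
lemma IsDirect.preservesWeakEquivalence_of_lt (hW : IsDirect W deg)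
    (hfin : ∀ c : C, {a : Over c | latchingArrows W deg c a.hom}.Finite)
    (hX : IsLatchingCofibrant W deg X) (hY : IsLatchingCofibrant W deg Y) (τ : X ⟶ Y)
    (hτ : ∀ c, WeakEquivalence (τ.app c)) (n : ℕ)
    (hn : ∀ c, deg c < n → PreservesWeakEquivalence τ (latchingArrows W deg c)) {d : C} (k : ℕ) :
    ∀ (P : ∀ ⦃c : C⦄, (c ⟶ d) → Prop), (∀ ⦃c⦄ (p : c ⟶ d), P p → W p) →
      (∀ ⦃b c : C⦄ (v : b ⟶ c) (p : c ⟶ d), W v → P p → P (v ≫ p)) →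
      (∀ ⦃c⦄ (p : c ⟶ d), P p → deg c < n) → {a : Over d | P a.hom}.Finite →
      {a : Over d | P a.hom}.ncard = k → PreservesWeakEquivalence τ P := by
  induction k with
  | zero =>
    intro P _ _ _ hPfin hk
    rw [Set.ncard_eq_zero hPfin] at hk
    have hP ⦃c : C⦄ (p : c ⟶ d) : ¬ P p := fun hp => by
      have : Over.mk p ∈ {a : Over d | P a.hom} := hp
      rw [hk] at this
      exact this
    refine ⟨fun K => K.isCofibrant_of_isEmpty hP, fun K => K.isCofibrant_of_isEmpty hP,
      fun K K' φ hφ => ?_⟩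
    obtain ⟨ψ, -⟩ := K'.exists_desc (Z := K.pt) (fun p hp => (hP p hp).elim)
      (fun v p hp => (hP p hp).elim)
    have : IsIso φ := ⟨ψ, K.hom_ext fun p hp => (hP p hp).elim,
      K'.hom_ext fun p hp => (hP p hp).elim⟩
    infer_instance
  | succ k ih =>
    intro P hPW hPc hPn hPfin hk
    obtain ⟨a, ha, hmax⟩ := Set.exists_max_image {a : Over d | P a.hom} (fun a => deg a.left)
      hPfin (Set.nonempty_of_ncard_ne_zero (by lia))
    obtain ⟨a, u, rfl⟩ := Over.mk_surjective a
    replace ha : P u := ha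
    replace hmax ⦃c : C⦄ (p : c ⟶ d) (hp : P p) : deg c ≤ deg a := hmax (Over.mk p) hp
    let P' ⦃c : C⦄ (p : c ⟶ d) : Prop := P p ∧ ¬ ∃ h : c = a, p = eqToHom h ≫ u
    have hP'c ⦃b c : C⦄ (v : b ⟶ c) (p : c ⟶ d) (hv : W v) (hp : P' p) : P' (v ≫ p) := by
      refine ⟨hPc v p hv hp.1, ?_⟩
      rintro ⟨rfl, h⟩
      obtain ⟨rfl, rfl⟩ := hW.exists_eqToHom hv (hmax _ hp.1)
      exact hp.2 ⟨rfl, by simpa using h⟩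
    have hset : {b : Over d | P' b.hom} = {b : Over d | P b.hom} \ {Over.mk u} := by
      ext b
      refine and_congr Iff.rfl (not_congr ⟨?_, ?_⟩)
      · obtain ⟨b, p, rfl⟩ := Over.mk_surjective b
        rintro ⟨h, h'⟩
        change b = a at h
        subst h
        change p = _ at h'
        rw [h']
        simp
      · rintro rfl
        exact ⟨rfl, (Category.id_comp _).symm⟩
    have hP'fin : {b : Over d | P' b.hom}.Finite := hPfin.subset fun b hb => hb.1
    have hP' := ih P' (fun c p hp => hPW p hp.1) hP'c (fun c p hp => hPn p hp.1) hP'fin (by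
      rw [hset, Set.ncard_sdiff_singleton_of_mem (a := Over.mk u) ha, hk]
      rfl)
    have hL := hn a (hPn u ha)
    obtain ⟨LX⟩ := nonempty_arrowColimit X (latchingArrows W deg a) (hfin a)
    obtain ⟨LY⟩ := nonempty_arrowColimit Y (latchingArrows W deg a) (hfin a)
    obtain ⟨X'⟩ := nonempty_arrowColimit X P' hP'fin
    obtain ⟨Y'⟩ := nonempty_arrowColimit Y P' hP'fin
    have hLX : Cofibration LX.toObj := hX a LX _ LX.ι_toObj
    have hLY : Cofibration LY.toObj := hY a LY _ LY.ι_toObj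
    have := hL.isCofibrant_left LX
    have := hL.isCofibrant_right LY
    have := hP'.isCofibrant_left X'
    have := hP'.isCofibrant_right Y'
    refine ⟨fun K => ?_, fun K => ?_, fun K K' φ hφ => ?_⟩
    · obtain ⟨f, k, -, -, sq⟩ := hW.exists_isPushout hPW hPc ha hmax (fun _ _ => Iff.rfl) LX X' K
      have : Cofibration k := by
        rw [cofibration_iff]
        exact MorphismProperty.of_isPushout sq hLX.mem
      exact isCofibrant_of_cofibration k
    · obtain ⟨f, k, -, -, sq⟩ := hW.exists_isPushout hPW hPc ha hmax (fun _ _ => Iff.rfl) LY Y' K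
      have : Cofibration k := by
        rw [cofibration_iff]
        exact MorphismProperty.of_isPushout sq hLY.mem
      exact isCofibrant_of_cofibration k
    · obtain ⟨f, k, hf, hk, sq⟩ :=
        hW.exists_isPushout hPW hPc ha hmax (fun _ _ => Iff.rfl) LX X' K
      obtain ⟨f', k', hf', hk', sq'⟩ :=
        hW.exists_isPushout hPW hPc ha hmax (fun _ _ => Iff.rfl) LY Y' K'
      obtain ⟨α, hα⟩ := LX.exists_map LY τ
      obtain ⟨β, hβ⟩ := X'.exists_map Y' τ
      have := hL.weakEquivalence LX LY α hα
      have := hP'.weakEquivalence X' Y' β hβ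
      have hLP' {b : C} (v : b ⟶ a) (hv : latchingArrows W deg a v) : P' (v ≫ u) := by
        refine ⟨hPc v u hv.1 ha, ?_⟩
        rintro ⟨rfl, -⟩
        exact hv.2.ne rfl
      refine weakEquivalence_of_isPushout sq sq' (α := α) (β := β) (γ := τ.app a) ?_ ?_ ?_ ?_
      · refine LX.hom_ext fun v hv => ?_
        rw [reassoc_of% (hf v hv (hLP' v hv)), hβ, reassoc_of% (hα v hv), hf' v hv (hLP' v hv)]
      · refine LX.hom_ext fun v hv => ?_
        rw [← Category.assoc, LX.ι_toObj, reassoc_of% (hα v hv), LY.ι_toObj, τ.naturality]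
      · refine X'.hom_ext fun p hp => ?_
        rw [reassoc_of% (hk p hp hp.1), hφ, reassoc_of% (hβ p hp), hk' p hp hp.1]
      · exact hφ u ha

/-- Reedy cofibrant diagrams have cofibrant latching objects, and an objectwise weak equivalence
between such diagrams induces weak equivalences of latching objects. -/
lemma IsDirect.preservesWeakEquivalence (hW : IsDirect W deg)
    (hfin : ∀ c : C, {a : Over c | latchingArrows W deg c a.hom}.Finite)
    (hX : IsLatchingCofibrant W deg X) (hY : IsLatchingCofibrant W deg Y) (τ : X ⟶ Y)
    (hτ : ∀ c, WeakEquivalence (τ.app c)) (c : C) :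
    PreservesWeakEquivalence τ (latchingArrows W deg c) := by
  induction h : deg c using Nat.strong_induction_on generalizing c with
  | h n ih =>
    subst h
    exact hW.preservesWeakEquivalence_of_lt hfin hX hY τ hτ (deg c)
      (fun b hb => ih _ hb b rfl) _ _ (fun b v hv => hv.1)
      (fun a b v p hv hp => ⟨hW.comp hv hp.1, (hW.le hv).trans_lt hp.2⟩) (fun b v hv => hv.2)
      (hfin c) rfl

end

end Reedy

/-! ### Left Quillen bifunctors -/

namespace HomotopicalAlgebra

universe v₁ v₂ v₃ u₁ u₂ u₃

/-- All models of the source of a pushout-product map are isomorphic over its target. -/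
lemma exists_iso_pushoutObjObj {M : Type u₁} [Category.{v₁} M] {V : Type u₂} [Category.{v₂} V]
    {N : Type u₃} [Category.{v₃} N] [HasPushouts N] {T : M ⥤ V ⥤ N} {A B : M} {K L : V}
    {i : A ⟶ B} {j : K ⟶ L}
    (sq : T.PushoutObjObj i j) :
    ∃ e : sq.pt ≅ (Functor.PushoutObjObj.ofHasPushout T i j).pt,
      sq.ι = e.hom ≫ (Functor.PushoutObjObj.ofHasPushout T i j).ι := by
  refine ⟨sq.isPushout.isoIsPushout _ _ (Functor.PushoutObjObj.ofHasPushout T i j).isPushout, ?_⟩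
  apply sq.hom_ext
  · rw [sq.inl_ι, IsPushout.inl_isoIsPushout_hom_assoc, Functor.PushoutObjObj.inl_ι]
  · rw [sq.inr_ι, IsPushout.inr_isoIsPushout_hom_assoc, Functor.PushoutObjObj.inr_ι]

variable {M : Type u₁} [Category.{v₁} M] [ModelCategory M] {V : Type u₂} [Category.{v₂} V]
  [ModelCategory V] {N : Type u₃} [Category.{v₃} N] [ModelCategory N]

/-- A left Quillen bifunctor: a bifunctor which is a left adjoint in each variable and satisfies
the pushout-product axiom. -/
structure IsLeftQuillenBifunctor (T : M ⥤ V ⥤ N) : Prop where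
  isLeftAdjoint_obj (A : M) : (T.obj A).IsLeftAdjoint
  isLeftAdjoint_flip_obj (K : V) : (T.flip.obj K).IsLeftAdjoint
  cofibration_ι {A B : M} {K L : V} (i : A ⟶ B) (j : K ⟶ L) (hi : Cofibration i)
    (hj : Cofibration j) : Cofibration (Functor.PushoutObjObj.ofHasPushout T i j).ι
  weakEquivalence_ι_left {A B : M} {K L : V} (i : A ⟶ B) (j : K ⟶ L) (hi : Cofibration i)
    (hj : Cofibration j) (hi' : WeakEquivalence i) :
    WeakEquivalence (Functor.PushoutObjObj.ofHasPushout T i j).ι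
  weakEquivalence_ι_right {A B : M} {K L : V} (i : A ⟶ B) (j : K ⟶ L) (hi : Cofibration i)
    (hj : Cofibration j) (hj' : WeakEquivalence j) :
    WeakEquivalence (Functor.PushoutObjObj.ofHasPushout T i j).ι

namespace IsLeftQuillenBifunctor

variable {T : M ⥤ V ⥤ N} (hT : IsLeftQuillenBifunctor T)

include hT

lemma cofibration_pushoutObjObj {A B : M} {K L : V} {i : A ⟶ B} {j : K ⟶ L}
    (sq : T.PushoutObjObj i j) (hi : Cofibration i) (hj : Cofibration j) : Cofibration sq.ι := by
  obtain ⟨e, he⟩ := exists_iso_pushoutObjObj sq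
  have := hT.cofibration_ι i j hi hj
  rw [he]
  infer_instance

lemma weakEquivalence_pushoutObjObj_ι_left {A B : M} {K L : V} {i : A ⟶ B} {j : K ⟶ L}
    (sq : T.PushoutObjObj i j) (hi : Cofibration i) (hj : Cofibration j)
    (hi' : WeakEquivalence i) : WeakEquivalence sq.ι := by
  obtain ⟨e, he⟩ := exists_iso_pushoutObjObj sq
  have := hT.weakEquivalence_ι_left i j hi hj hi'
  rw [he]
  infer_instance

lemma weakEquivalence_pushoutObjObj_ι_right {A B : M} {K L : V} {i : A ⟶ B} {j : K ⟶ L}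
    (sq : T.PushoutObjObj i j) (hi : Cofibration i) (hj : Cofibration j)
    (hj' : WeakEquivalence j) : WeakEquivalence sq.ι := by
  obtain ⟨e, he⟩ := exists_iso_pushoutObjObj sq
  have := hT.weakEquivalence_ι_right i j hi hj hj'
  rw [he]
  infer_instance

lemma cofibration_obj_map (A : M) [hA : IsCofibrant A] {K L : V} (j : K ⟶ L)
    [hj : Cofibration j] : Cofibration ((T.obj A).map j) := by
  have := hT.isLeftAdjoint_flip_obj
  exact hT.cofibration_pushoutObjObj
    (Functor.PushoutObjObj.ofIsInitialLeft T (initial.to A) j initialIsInitial) hA hj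

lemma weakEquivalence_obj_map_of_cofibration (A : M) [hA : IsCofibrant A] {K L : V} (j : K ⟶ L)
    [hj : Cofibration j] [hj' : WeakEquivalence j] : WeakEquivalence ((T.obj A).map j) := by
  have := hT.isLeftAdjoint_flip_obj
  exact hT.weakEquivalence_pushoutObjObj_ι_right
    (Functor.PushoutObjObj.ofIsInitialLeft T (initial.to A) j initialIsInitial) hA hj hj'

lemma weakEquivalence_map_app_of_cofibration (K : V) [hK : IsCofibrant K] {A B : M} (i : A ⟶ B)
    [hi : Cofibration i] [hi' : WeakEquivalence i] : WeakEquivalence ((T.map i).app K) := by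
  have := hT.isLeftAdjoint_obj
  exact hT.weakEquivalence_pushoutObjObj_ι_left
    (Functor.PushoutObjObj.ofIsInitialRight T i (initial.to K) initialIsInitial) hi hK hi'

lemma isCofibrant_obj_obj (A : M) [IsCofibrant A] (K : V) [IsCofibrant K] :
    IsCofibrant ((T.obj A).obj K) := by
  have := hT.isLeftAdjoint_obj A
  have := hT.cofibration_obj_map A (initial.to K)
  exact (isCofibrant_iff_of_isInitial ((T.obj A).map (initial.to K))
    (IsInitial.isInitialObj (T.obj A) _ initialIsInitial)).mpr this

lemma weakEquivalence_map_app (K : V) [IsCofibrant K] {A B : M} (i : A ⟶ B)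
    [IsCofibrant A] [IsCofibrant B] [WeakEquivalence i] : WeakEquivalence ((T.map i).app K) :=
  weakEquivalence_map_of_trivialCofibrations (T.flip.obj K)
    (fun _ _ i _ _ _ => hT.weakEquivalence_map_app_of_cofibration K i) i

lemma weakEquivalence_obj_map (A : M) [IsCofibrant A] {K L : V} (j : K ⟶ L)
    [IsCofibrant K] [IsCofibrant L] [WeakEquivalence j] : WeakEquivalence ((T.obj A).map j) :=
  weakEquivalence_map_of_trivialCofibrations (T.obj A)
    (fun _ _ j _ _ _ => hT.weakEquivalence_obj_map_of_cofibration A j) j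

lemma weakEquivalence_map {A B : M} {K L : V} (i : A ⟶ B) (j : K ⟶ L) [IsCofibrant A]
    [IsCofibrant B] [IsCofibrant K] [IsCofibrant L] [WeakEquivalence i] [WeakEquivalence j] :
    WeakEquivalence ((T.map i).app K ≫ (T.obj B).map j) := by
  have := hT.weakEquivalence_map_app K i
  have := hT.weakEquivalence_obj_map B j
  infer_instance

lemma isCofibrant_pushoutObjObj {A B : M} {K L : V} {i : A ⟶ B} {j : K ⟶ L}
    (sq : T.PushoutObjObj i j) [IsCofibrant A] [IsCofibrant B] [IsCofibrant K] [Cofibration j] :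
    IsCofibrant sq.pt := by
  have := hT.isCofibrant_obj_obj B K
  have : Cofibration sq.inl := by
    rw [cofibration_iff]
    exact MorphismProperty.of_isPushout sq.isPushout (hT.cofibration_obj_map A j).mem
  exact isCofibrant_of_cofibration sq.inl

/-- The source of the pushout-product map is homotopy invariant, by the gluing lemma. -/
lemma weakEquivalence_pushoutObjObj {A B A' B' : M} {K L K' L' : V} {i : A ⟶ B} {j : K ⟶ L}
    {i' : A' ⟶ B'} {j' : K' ⟶ L'} (sq : T.PushoutObjObj i j) (sq' : T.PushoutObjObj i' j')
    {α : A ⟶ A'} {β : B ⟶ B'} {κ : K ⟶ K'} {l : L ⟶ L'} (hi : i ≫ β = α ≫ i')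
    (hj : j ≫ l = κ ≫ j') [IsCofibrant A] [IsCofibrant A'] [IsCofibrant K] [IsCofibrant K']
    [Cofibration i] [Cofibration i'] [Cofibration j] [Cofibration j']
    [WeakEquivalence α] [WeakEquivalence β] [WeakEquivalence κ] [WeakEquivalence l]
    (φ : sq.pt ⟶ sq'.pt) (hφ : sq.inl ≫ φ = ((T.map β).app K ≫ (T.obj B').map κ) ≫ sq'.inl)
    (hφ' : sq.inr ≫ φ = ((T.map α).app L ≫ (T.obj A').map l) ≫ sq'.inr) :
    WeakEquivalence φ := by
  have : IsCofibrant B := isCofibrant_of_cofibration i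
  have : IsCofibrant B' := isCofibrant_of_cofibration i'
  have : IsCofibrant L := isCofibrant_of_cofibration j
  have : IsCofibrant L' := isCofibrant_of_cofibration j'
  have := hT.isCofibrant_obj_obj A K
  have := hT.isCofibrant_obj_obj B K
  have := hT.isCofibrant_obj_obj A' K'
  have := hT.isCofibrant_obj_obj B' K'
  have := hT.cofibration_obj_map A j
  have := hT.cofibration_obj_map A' j'
  have := hT.weakEquivalence_map α κ
  have := hT.weakEquivalence_map β κ
  have := hT.weakEquivalence_map α l
  refine weakEquivalence_of_isPushout sq.isPushout sq'.isPushout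
    (α := (T.map α).app K ≫ (T.obj A').map κ) ?_ ?_ hφ hφ'
  · rw [← NatTrans.comp_app_assoc, ← T.map_comp, hi, T.map_comp, NatTrans.comp_app,
      Category.assoc, Category.assoc, NatTrans.naturality]
  · rw [NatTrans.naturality_assoc, ← Functor.map_comp, hj, Functor.map_comp, Category.assoc]

end IsLeftQuillenBifunctor

end HomotopicalAlgebra

namespace Reedy

/-- Left adjoints preserve colimits. -/
noncomputable def ArrowColimit.map {C : Type} [SmallCategory C] {M : Type u} [Category.{v} M]
    {N : Type u'} [Category.{v'} N] {X : C ⥤ M} {d : C} {P : ∀ ⦃c : C⦄, (c ⟶ d) → Prop}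
    (K : ArrowColimit X P) (F : M ⥤ N) [F.IsLeftAdjoint] : ArrowColimit (X ⋙ F) P where
  pt := F.obj K.pt
  ι p hp := F.map (K.ι p hp)
  w v p hp hvp := by rw [Functor.comp_map, ← F.map_comp, K.w]
  exists_desc {Z} ψ hψ := by
    let adj := Adjunction.ofIsLeftAdjoint F
    obtain ⟨φ, hφ⟩ := K.exists_desc (fun p hp => adj.homEquiv _ _ (ψ p hp))
      (fun v p hp hvp => by
        rw [← adj.homEquiv_naturality_left, ← hψ v p hp hvp]
        rfl)
    refine ⟨(adj.homEquiv _ _).symm φ, fun p hp => ?_⟩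
    rw [← adj.homEquiv_naturality_left_symm, hφ, Equiv.symm_apply_apply]
  hom_ext {Z φ φ'} h := by
    let adj := Adjunction.ofIsLeftAdjoint F
    apply (adj.homEquiv _ _).injective
    refine K.hom_ext fun p hp => ?_
    rw [← adj.homEquiv_naturality_left, ← adj.homEquiv_naturality_left, h]

end Reedy

/-! ### The skeletal filtration of a coend over the simplex category -/

namespace Reedy

/-- The degree of an object of the opposite of the simplex category. -/
abbrev opLen (n : SimplexCategoryᵒᵖ) : ℕ := n.unop.len

lemma isDirect_monomorphisms :
    IsDirect (MorphismProperty.monomorphisms SimplexCategory) SimplexCategory.len where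
  comp hf hg := MorphismProperty.comp_mem _ _ _ hf hg
  of_comp f g h := by
    have : Mono (f ≫ g) := h
    exact mono_of_mono f g
  le {a b f} h := by
    have : Mono f := h
    exact SimplexCategory.len_le_of_mono f
  exists_eqToHom {a b f} h hab := by
    have : Mono f := h
    obtain rfl : a = b := SimplexCategory.ext
      (le_antisymm (SimplexCategory.len_le_of_mono f) hab)
    exact ⟨rfl, SimplexCategory.eq_id_of_mono f⟩

lemma isDirect_op_epimorphisms :
    IsDirect (MorphismProperty.epimorphisms SimplexCategory).op opLen where
  comp hf hg := MorphismProperty.comp_mem _ _ _ hf hg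
  of_comp f g h := by
    have : Epi (g.unop ≫ f.unop) := h
    exact epi_of_epi g.unop f.unop
  le {a b f} h := by
    have : Epi f.unop := h
    exact SimplexCategory.len_le_of_epi f.unop
  exists_eqToHom {a b f} h hab := by
    have : Epi f.unop := h
    obtain ⟨a⟩ := a
    obtain ⟨b⟩ := b
    obtain rfl : a = b := SimplexCategory.ext
      (le_antisymm (SimplexCategory.len_le_of_epi f.unop) hab)
    exact ⟨rfl, Quiver.Hom.unop_inj (SimplexCategory.eq_id_of_epi f.unop)⟩

/-- The injections to `[n]` from objects of smaller dimension. -/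
abbrev faceArrows (n : SimplexCategory) ⦃m : SimplexCategory⦄ (δ : m ⟶ n) : Prop :=
  latchingArrows (MorphismProperty.monomorphisms SimplexCategory) SimplexCategory.len n δ

/-- The surjections from `[n]` to objects of smaller dimension. -/
abbrev degeneracyArrows (n : SimplexCategory) ⦃m : SimplexCategoryᵒᵖ⦄ (σ : m ⟶ op n) : Prop :=
  latchingArrows (MorphismProperty.epimorphisms SimplexCategory).op opLen (op n) σ

instance finite_hom_op (a b : SimplexCategoryᵒᵖ) : Finite (a ⟶ b) :=
  Finite.of_injective Quiver.Hom.unop Quiver.Hom.unop_inj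

lemma finite_faceArrows (n : SimplexCategory) : {a : Over n | faceArrows n a.hom}.Finite := by
  have : Finite (InjectionsTo n) := inferInstance
  refine Set.Finite.subset (Set.finite_range fun a : InjectionsTo n => a.obj) ?_
  exact fun a ha => ⟨⟨a, ha⟩, rfl⟩

lemma finite_degeneracyArrows (n : SimplexCategory) :
    {a : Over (op n) | degeneracyArrows n a.hom}.Finite := by
  have : Finite (SurjectionsFrom n) := inferInstance
  refine Set.Finite.subset (Set.finite_range fun a : SurjectionsFrom n =>
    Over.mk a.obj.hom.op) ?_
  exact fun a ha => ⟨⟨Under.mk a.hom.unop, ha⟩, rfl⟩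

universe v₁ v₂ v₃ u₁ u₂ u₃

variable {M : Type u₁} [Category.{v₁} M] {V : Type u₂} [Category.{v₂} V]
  {N : Type u₃} [Category.{v₃} N]

/-- The coend of `T (X_k, I^k)` over the full subcategory of the simplex category given by `P`,
described by its universal property. -/
structure PartialCoend (T : M ⥤ V ⥤ N) (X : SimplexCategoryᵒᵖ ⥤ M) (I : SimplexCategory ⥤ V)
    (P : SimplexCategory → Prop) where
  /-- the coend -/
  pt : N
  /-- the inclusions -/
  ι (k : SimplexCategory) (hk : P k) : (T.obj (X.obj (op k))).obj (I.obj k) ⟶ pt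
  w {k l : SimplexCategory} (a : k ⟶ l) (hk : P k) (hl : P l) :
    (T.map (X.map a.op)).app (I.obj k) ≫ ι k hk = (T.obj (X.obj (op l))).map (I.map a) ≫ ι l hl
  exists_desc {Z : N} (ψ : ∀ k, P k → ((T.obj (X.obj (op k))).obj (I.obj k) ⟶ Z))
    (hψ : ∀ {k l : SimplexCategory} (a : k ⟶ l) (hk : P k) (hl : P l),
      (T.map (X.map a.op)).app (I.obj k) ≫ ψ k hk =
        (T.obj (X.obj (op l))).map (I.map a) ≫ ψ l hl) :
    ∃ φ : pt ⟶ Z, ∀ k (hk : P k), ι k hk ≫ φ = ψ k hk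
  hom_ext {Z : N} {φ φ' : pt ⟶ Z} (h : ∀ k (hk : P k), ι k hk ≫ φ = ι k hk ≫ φ') : φ = φ'

/-- The bifunctor `([k], [l]) ↦ T (X_k, I^l)`. -/
abbrev bifunctorComp (T : M ⥤ V ⥤ N) (X : SimplexCategoryᵒᵖ ⥤ M) (I : SimplexCategory ⥤ V) :
    SimplexCategoryᵒᵖ ⥤ SimplexCategory ⥤ N :=
  X ⋙ T ⋙ (Functor.whiskeringLeft _ _ _).obj I

namespace PartialCoend

variable {T : M ⥤ V ⥤ N} {X : SimplexCategoryᵒᵖ ⥤ M} {I : SimplexCategory ⥤ V}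
  {P : SimplexCategory → Prop}

lemma nonempty [HasColimitsOfSize.{0, 0} N] (T : M ⥤ V ⥤ N) (X : SimplexCategoryᵒᵖ ⥤ M)
    (I : SimplexCategory ⥤ V) (P : SimplexCategory → Prop) :
    Nonempty (PartialCoend T X I P) := by
  let Q : ObjectProperty SimplexCategory := P
  let F : Q.FullSubcategoryᵒᵖ ⥤ Q.FullSubcategory ⥤ N :=
    (Q.ι.op ⋙ X) ⋙ T ⋙ (Functor.whiskeringLeft _ _ _).obj (Q.ι ⋙ I)
  exact ⟨{
    pt := coend F
    ι := fun k hk => coend.ι F ⟨k, hk⟩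
    w := fun {k l} a hk hl => coend.condition F (i := ⟨k, hk⟩) (j := ⟨l, hl⟩)
      (ObjectProperty.homMk a)
    exists_desc := fun ψ hψ => ⟨coend.desc (F := F) (fun k => ψ k.obj k.property)
      (fun _ _ a => hψ a.hom _ _), fun _ _ => coend.ι_desc _ _ _⟩
    hom_ext := fun h => coend.hom_ext fun k => h k.obj k.property }⟩

/-- The coend over the simplex category as a `PartialCoend`. -/
noncomputable def ofCoend (T : M ⥤ V ⥤ N) (X : SimplexCategoryᵒᵖ ⥤ M) (I : SimplexCategory ⥤ V)
    [HasCoend (bifunctorComp T X I)] : PartialCoend T X I (fun _ => True) where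
  pt := coend (bifunctorComp T X I)
  ι k _ := coend.ι (bifunctorComp T X I) k
  w a _ _ := coend.condition (bifunctorComp T X I) a
  exists_desc ψ hψ := ⟨coend.desc (F := bifunctorComp T X I) (fun k => ψ k trivial)
    (fun _ _ a => hψ a _ _), fun _ _ => coend.ι_desc _ _ _⟩
  hom_ext h := coend.hom_ext fun k => h k trivial

lemma hom_ext_right {d : SimplexCategory} (hT : ∀ A, (T.obj A).IsLeftAdjoint)
    (L' : ArrowColimit I (faceArrows d)) (A : M) {Z : N} {φ φ' : (T.obj A).obj L'.pt ⟶ Z}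
    (h : ∀ {m} (δ : m ⟶ d) (hδ : faceArrows d δ),
      (T.obj A).map (L'.ι δ hδ) ≫ φ = (T.obj A).map (L'.ι δ hδ) ≫ φ') : φ = φ' :=
  have := hT A
  (L'.map (T.obj A)).hom_ext h

lemma hom_ext_left {d : SimplexCategory} (hT : ∀ A, (T.flip.obj A).IsLeftAdjoint)
    (L : ArrowColimit X (degeneracyArrows d)) (A : V) {Z : N} {φ φ' : (T.obj L.pt).obj A ⟶ Z}
    (h : ∀ {m} (σ : op m ⟶ op d) (hσ : degeneracyArrows d σ),
      (T.map (L.ι σ hσ)).app A ≫ φ = (T.map (L.ι σ hσ)).app A ≫ φ') : φ = φ' :=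
  have := hT A
  (L.map (T.flip.obj A)).hom_ext (fun {m} => by
    obtain ⟨m⟩ := m
    exact h)

/-- One step of the skeletal filtration: attaching `T (X_d, I^d)` along the pushout-product of the
latching maps. A dinatural family in dimensions `≤ d` is determined by its restriction to
dimensions `< d` and its component at `d`, and the only condition on the latter is its
compatibility with faces and degeneracies, as maps in the simplex category factor as a
surjection followed by an injection. -/
lemma exists_isPushout {d : SimplexCategory} {P P' : SimplexCategory → Prop}
    (hP : ∀ k, P k ↔ k.len ≤ d.len) (hP' : ∀ k, P' k ↔ k.len < d.len)
    (L : ArrowColimit X (degeneracyArrows d)) (L' : ArrowColimit I (faceArrows d))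
    (hT₁ : ∀ A, (T.obj A).IsLeftAdjoint) (hT₂ : ∀ A, (T.flip.obj A).IsLeftAdjoint)
    (sq : T.PushoutObjObj L.toObj L'.toObj) (K' : PartialCoend T X I P')
    (K : PartialCoend T X I P) (hd : P d) :
    ∃ (f : sq.pt ⟶ K'.pt) (k : K'.pt ⟶ K.pt),
      (∀ {m} (δ : m ⟶ d) (hδ : faceArrows d δ) (hm : P' m),
        (T.obj (X.obj (op d))).map (L'.ι δ hδ) ≫ sq.inl ≫ f =
          (T.map (X.map δ.op)).app (I.obj m) ≫ K'.ι m hm) ∧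
      (∀ {m} (σ : op m ⟶ op d) (hσ : degeneracyArrows d σ) (hm : P' m),
        (T.map (L.ι σ hσ)).app (I.obj d) ≫ sq.inr ≫ f =
          (T.obj (X.obj (op m))).map (I.map σ.unop) ≫ K'.ι m hm) ∧
      (∀ m (hm : P' m) (hm' : P m), K'.ι m hm ≫ k = K.ι m hm') ∧
      IsPushout f sq.ι k (K.ι d hd) := by
  obtain ⟨f₁, hf₁⟩ : ∃ f₁ : (T.obj (X.obj (op d))).obj L'.pt ⟶ K'.pt,
      ∀ {m} (δ : m ⟶ d) (hδ : faceArrows d δ), (T.obj (X.obj (op d))).map (L'.ι δ hδ) ≫ f₁ =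
        (T.map (X.map δ.op)).app (I.obj m) ≫ K'.ι m ((hP' m).mpr hδ.2) := by
    refine (L'.map (T.obj (X.obj (op d)))).exists_desc (fun {m} δ hδ =>
      (T.map (X.map δ.op)).app (I.obj m) ≫ K'.ι m ((hP' m).mpr hδ.2)) (fun {m m'} v δ hδ hvδ => ?_)
    rw [Functor.comp_map, NatTrans.naturality_assoc, ← K'.w v ((hP' m).mpr hvδ.2), op_comp,
      X.map_comp, T.map_comp, NatTrans.comp_app, Category.assoc]
  obtain ⟨f₂, hf₂⟩ : ∃ f₂ : (T.obj L.pt).obj (I.obj d) ⟶ K'.pt,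
      ∀ {m} (σ : op m ⟶ op d) (hσ : degeneracyArrows d σ),
        (T.map (L.ι σ hσ)).app (I.obj d) ≫ f₂ =
          (T.obj (X.obj (op m))).map (I.map σ.unop) ≫ K'.ι m ((hP' m).mpr hσ.2) := by
    obtain ⟨f₂, hf₂⟩ := (L.map (T.flip.obj (I.obj d))).exists_desc (fun {m} σ hσ =>
      (T.obj (X.obj m)).map (I.map σ.unop) ≫ K'.ι m.unop ((hP' _).mpr hσ.2))
      (fun {m m'} v σ hσ hvσ => by
        change (T.map (X.map v)).app (I.obj d) ≫ _ = _
        obtain ⟨m⟩ := m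
        obtain ⟨m'⟩ := m'
        obtain ⟨v, rfl⟩ : ∃ v', v = Quiver.Hom.op v' := ⟨v.unop, rfl⟩
        rw [← NatTrans.naturality_assoc, K'.w v ((hP' _).mpr hσ.2) ((hP' _).mpr hvσ.2),
          unop_comp, I.map_comp, Functor.map_comp, Category.assoc]
        rfl)
    exact ⟨f₂, fun σ hσ => hf₂ σ hσ⟩
  obtain ⟨k, hk⟩ := K'.exists_desc (fun m hm => K.ι m ((hP m).mpr ((hP' m).mp hm).le))
    (fun a hk hl => K.w a _ _)
  have hf : (T.map L.toObj).app L'.pt ≫ f₁ = (T.obj L.pt).map L'.toObj ≫ f₂ := by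
    refine hom_ext_left hT₂ L _ fun {m} σ hσ => hom_ext_right hT₁ L' _ fun {m'} δ hδ => ?_
    rw [← NatTrans.comp_app_assoc, ← T.map_comp, L.ι_toObj, NatTrans.naturality_assoc, hf₁,
      ← NatTrans.naturality_assoc, hf₂, ← Functor.map_comp_assoc, L'.ι_toObj,
      ← NatTrans.comp_app_assoc, ← T.map_comp, ← X.map_comp, ← Functor.map_comp_assoc,
      ← I.map_comp]
    exact K'.w (δ ≫ σ.unop) _ _
  let f : sq.pt ⟶ K'.pt := sq.isPushout.desc f₁ f₂ hf
  have hinl : sq.inl ≫ f = f₁ := sq.isPushout.inl_desc _ _ _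
  have hinr : sq.inr ≫ f = f₂ := sq.isPushout.inr_desc _ _ _
  refine ⟨f, k, fun δ hδ hm => by rw [hinl, hf₁], fun σ hσ hm => by rw [hinr, hf₂],
    fun m hm _ => hk m hm, ?_⟩
  have w : f ≫ k = sq.ι ≫ K.ι d hd := by
    apply sq.hom_ext
    · rw [← Category.assoc, hinl, sq.inl_ι_assoc]
      refine hom_ext_right hT₁ L' _ fun {m} δ hδ => ?_
      rw [reassoc_of% (hf₁ δ hδ), hk, ← Functor.map_comp_assoc, L'.ι_toObj]
      exact K.w δ _ _
    · rw [← Category.assoc, hinr, sq.inr_ι_assoc]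
      refine hom_ext_left hT₂ L _ fun {m} σ hσ => ?_
      rw [reassoc_of% (hf₂ σ hσ), hk, ← NatTrans.comp_app_assoc, ← T.map_comp, L.ι_toObj]
      exact (K.w σ.unop _ _).symm
  have key (s : PushoutCocone f sq.ι) : ∃ φ : K.pt ⟶ s.pt, k ≫ φ = s.inl ∧
      K.ι d hd ≫ φ = s.inr := by
    have face {m : SimplexCategory} (δ : m ⟶ d) [Mono δ] (hm : m.len < d.len) :
        (T.obj (X.obj (op d))).map (I.map δ) ≫ s.inr =
          (T.map (X.map δ.op)).app (I.obj m) ≫ K'.ι m ((hP' m).mpr hm) ≫ s.inl := by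
      have hδ : faceArrows d δ := ⟨MorphismProperty.monomorphisms.infer_property δ, hm⟩
      have h := (T.obj (X.obj (op d))).map (L'.ι δ hδ) ≫= sq.inl ≫= s.condition
      rw [reassoc_of% hinl, reassoc_of% (hf₁ δ hδ), sq.inl_ι_assoc,
        ← Functor.map_comp_assoc, L'.ι_toObj] at h
      exact h.symm
    have degeneracy {m : SimplexCategory} (σ : d ⟶ m) [Epi σ] (hm : m.len < d.len) :
        (T.map (X.map σ.op)).app (I.obj d) ≫ s.inr =
          (T.obj (X.obj (op m))).map (I.map σ) ≫ K'.ι m ((hP' m).mpr hm) ≫ s.inl := by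
      have hσ : degeneracyArrows d σ.op :=
        ⟨MorphismProperty.epimorphisms.infer_property σ, hm⟩
      have h := (T.map (L.ι σ.op hσ)).app (I.obj d) ≫= sq.inr ≫= s.condition
      rw [reassoc_of% hinr, reassoc_of% (hf₂ σ.op hσ), sq.inr_ι_assoc,
        ← NatTrans.comp_app_assoc, ← T.map_comp, L.ι_toObj] at h
      exact h.symm
    classical
    have lt_of_ne {m : SimplexCategory} (hm : P m) (h : m ≠ d) : m.len < d.len :=
      lt_of_le_of_ne ((hP m).mp hm) fun h' => h (SimplexCategory.ext h')
    let ψ (m : SimplexCategory) (hm : P m) : (T.obj (X.obj (op m))).obj (I.obj m) ⟶ s.pt :=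
      if h : m = d then eqToHom (by rw [h]) ≫ s.inr
      else K'.ι m ((hP' m).mpr (lt_of_ne hm h)) ≫ s.inl
    have ψ_d (hd : P d) : ψ d hd = s.inr := by
      simp only [ψ, dif_pos, eqToHom_refl, Category.id_comp]
    have ψ_P' {m : SimplexCategory} (hm : P m) (hm' : P' m) : ψ m hm = K'.ι m hm' ≫ s.inl :=
      dif_neg (by
        rintro rfl
        exact ((hP' m).mp hm').ne rfl)
    -- the components of the family are compatible with injections and surjections between
    -- distinct objects
    have ψ_face {m l : SimplexCategory} (δ : m ⟶ l) [Mono δ] (hm : P m) (hl : P l)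
        (hml : m.len < l.len) : (T.map (X.map δ.op)).app (I.obj m) ≫ ψ m hm =
          (T.obj (X.obj (op l))).map (I.map δ) ≫ ψ l hl := by
      have hm' : m.len < d.len := hml.trans_le ((hP l).mp hl)
      rw [ψ_P' hm ((hP' m).mpr hm')]
      by_cases h : l = d
      · subst h
        rw [ψ_d hl, face δ hml]
      · rw [ψ_P' hl ((hP' l).mpr (lt_of_ne hl h)), ← Category.assoc, K'.w δ, Category.assoc]
    have ψ_degeneracy {m l : SimplexCategory} (σ : l ⟶ m) [Epi σ] (hm : P m) (hl : P l)
        (hml : m.len < l.len) : (T.map (X.map σ.op)).app (I.obj l) ≫ ψ l hl =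
          (T.obj (X.obj (op m))).map (I.map σ) ≫ ψ m hm := by
      have hm' : m.len < d.len := hml.trans_le ((hP l).mp hl)
      rw [ψ_P' hm ((hP' m).mpr hm')]
      by_cases h : l = d
      · subst h
        rw [ψ_d hl, degeneracy σ hml]
      · rw [ψ_P' hl ((hP' l).mpr (lt_of_ne hl h)), ← Category.assoc, K'.w σ, Category.assoc]
    have ψ_mono {m l : SimplexCategory} (δ : m ⟶ l) [Mono δ] (hm : P m) (hl : P l) :
        (T.map (X.map δ.op)).app (I.obj m) ≫ ψ m hm =
          (T.obj (X.obj (op l))).map (I.map δ) ≫ ψ l hl := by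
      rcases (SimplexCategory.len_le_of_mono δ).lt_or_eq with h | h
      · exact ψ_face δ hm hl h
      · obtain rfl := SimplexCategory.ext h
        simp [SimplexCategory.eq_id_of_mono δ]
    have ψ_epi {m l : SimplexCategory} (σ : l ⟶ m) [Epi σ] (hm : P m) (hl : P l) :
        (T.map (X.map σ.op)).app (I.obj l) ≫ ψ l hl =
          (T.obj (X.obj (op m))).map (I.map σ) ≫ ψ m hm := by
      rcases (SimplexCategory.len_le_of_epi σ).lt_or_eq with h | h
      · exact ψ_degeneracy σ hm hl h
      · obtain rfl := SimplexCategory.ext h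
        simp [SimplexCategory.eq_id_of_epi σ]
    obtain ⟨φ, hφ⟩ := K.exists_desc ψ (fun {l l'} a hl hl' => by
      have hm : P (image a) :=
        (hP _).mpr ((SimplexCategory.len_le_of_mono (image.ι a)).trans ((hP l').mp hl'))
      rw [← image.fac a, op_comp, X.map_comp, T.map_comp, NatTrans.comp_app, Category.assoc,
        ψ_epi (factorThruImage a) hm hl, ← NatTrans.naturality_assoc, ψ_mono (image.ι a) hm hl',
        I.map_comp, Functor.map_comp, Category.assoc])
    refine ⟨φ, K'.hom_ext fun m hm => ?_, ?_⟩
    · rw [reassoc_of% (hk m hm), hφ, ψ_P' ((hP m).mpr ((hP' m).mp hm).le) hm]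
    · rw [hφ, ψ_d hd]
  choose φ hφ₁ hφ₂ using key
  refine ⟨⟨w⟩, ⟨PushoutCocone.IsColimit.mk _ φ hφ₁ hφ₂ (fun s m h₁ h₂ => ?_)⟩⟩
  refine K.hom_ext fun l hl => ?_
  by_cases h : l = d
  · subst h
    rw [h₂, hφ₂]
  · have hl' := (hP' l).mpr (lt_of_le_of_ne ((hP l).mp hl)
        (fun h' => h (SimplexCategory.ext h')))
    rw [← hk l hl', Category.assoc, Category.assoc, h₁, hφ₁]

end PartialCoend

end Reedy

/-! ### Homotopy invariance of the coend -/

namespace Reedy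

universe v₁ v₂ v₃ u₁ u₂ u₃

section

variable {M : Type u₁} [Category.{v₁} M] {V : Type u₂} [Category.{v₂} V]
  {N : Type u₃} [Category.{v₃} N] {T : M ⥤ V ⥤ N} {X Y : SimplexCategoryᵒᵖ ⥤ M}
  {I J : SimplexCategory ⥤ V}

lemma exists_pushoutObjObj_map {A B A' B' : M} {K L K' L' : V} {i : A ⟶ B} {j : K ⟶ L}
    {i' : A' ⟶ B'} {j' : K' ⟶ L'} (sq : T.PushoutObjObj i j) (sq' : T.PushoutObjObj i' j')
    {α : A ⟶ A'} {β : B ⟶ B'} {κ : K ⟶ K'} {l : L ⟶ L'} (hi : i ≫ β = α ≫ i')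
    (hj : j ≫ l = κ ≫ j') :
    ∃ φ : sq.pt ⟶ sq'.pt, sq.inl ≫ φ = ((T.map β).app K ≫ (T.obj B').map κ) ≫ sq'.inl ∧
      sq.inr ≫ φ = ((T.map α).app L ≫ (T.obj A').map l) ≫ sq'.inr ∧
      φ ≫ sq'.ι = sq.ι ≫ (T.map β).app L ≫ (T.obj B').map l := by
  have w : (T.map i).app K ≫ ((T.map β).app K ≫ (T.obj B').map κ) ≫ sq'.inl =
      (T.obj A).map j ≫ ((T.map α).app L ≫ (T.obj A').map l) ≫ sq'.inr := by
    simp only [Category.assoc]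
    rw [← NatTrans.comp_app_assoc, ← T.map_comp, hi, NatTrans.naturality_assoc,
      ← Functor.map_comp_assoc, hj, T.map_comp, NatTrans.comp_app, Category.assoc,
      ← NatTrans.naturality_assoc, sq'.isPushout.w, Functor.map_comp, Category.assoc]
  refine ⟨sq.isPushout.desc _ _ w, sq.isPushout.inl_desc _ _ _, sq.isPushout.inr_desc _ _ _, ?_⟩
  apply sq.hom_ext
  · rw [sq.isPushout.inl_desc_assoc, sq.inl_ι_assoc, Category.assoc, sq'.inl_ι,
      NatTrans.naturality_assoc, Category.assoc, ← Functor.map_comp, ← Functor.map_comp, hj]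
  · rw [sq.isPushout.inr_desc_assoc, sq.inr_ι_assoc, Category.assoc, sq'.inr_ι,
      ← NatTrans.comp_app_assoc, ← T.map_comp, hi, T.map_comp, NatTrans.comp_app, Category.assoc,
      Category.assoc, NatTrans.naturality]

namespace PartialCoend

lemma exists_map {P : SimplexCategory → Prop} (K : PartialCoend T X I P)
    (K' : PartialCoend T Y J P) (f : X ⟶ Y) (g : I ⟶ J) :
    ∃ φ : K.pt ⟶ K'.pt, ∀ k (hk : P k), K.ι k hk ≫ φ =
      ((T.map (f.app (op k))).app (I.obj k) ≫ (T.obj (Y.obj (op k))).map (g.app k)) ≫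
        K'.ι k hk :=
  K.exists_desc (fun k hk => ((T.map (f.app (op k))).app (I.obj k) ≫
    (T.obj (Y.obj (op k))).map (g.app k)) ≫ K'.ι k hk) (fun {k l} a hk hl => by
      simp only [Category.assoc]
      rw [← NatTrans.comp_app_assoc, ← T.map_comp, f.naturality, T.map_comp, NatTrans.comp_app,
        Category.assoc, ← NatTrans.naturality_assoc, K'.w a hk hl, NatTrans.naturality_assoc,
        ← Functor.map_comp_assoc, ← Functor.map_comp_assoc, g.naturality])

lemma exists_incl {P P' : SimplexCategory → Prop} (h : ∀ k, P' k → P k)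
    (K' : PartialCoend T X I P') (K : PartialCoend T X I P) :
    ∃ φ : K'.pt ⟶ K.pt, ∀ k (hk : P' k), K'.ι k hk ≫ φ = K.ι k (h k hk) :=
  K'.exists_desc (fun k hk => K.ι k (h k hk)) (fun a _ _ => K.w a _ _)

end PartialCoend

variable [HasColimitsOfSize.{0, 0} N]

variable (T X I) in
/-- The coend of `T (X_k, I^k)` over `k < n`. -/
noncomputable def skeleton (n : ℕ) : PartialCoend T X I (fun k => k.len < n) :=
  (PartialCoend.nonempty T X I _).some

variable (T X I) in
/-- The inclusion of a skeleton in the next one. -/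
noncomputable def skeletonSucc (n : ℕ) : (skeleton T X I n).pt ⟶ (skeleton T X I (n + 1)).pt :=
  (PartialCoend.exists_incl (fun _ h => Nat.lt_succ_of_lt h) (skeleton T X I n)
    (skeleton T X I (n + 1))).choose

lemma ι_skeletonSucc {n : ℕ} (k : SimplexCategory) (hk : k.len < n) (hk' : k.len < n + 1) :
    (skeleton T X I n).ι k hk ≫ skeletonSucc T X I n = (skeleton T X I (n + 1)).ι k hk' :=
  (PartialCoend.exists_incl (fun _ h => Nat.lt_succ_of_lt h) (skeleton T X I n)
    (skeleton T X I (n + 1))).choose_spec k hk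

variable (T X I) in
/-- The skeletal filtration. -/
noncomputable def skeletonFunctor : ℕ ⥤ N :=
  Functor.ofSequence (X := fun n => (skeleton T X I n).pt) (skeletonSucc T X I)

lemma skeletonFunctor_map_succ (n : ℕ) :
    (skeletonFunctor T X I).map (homOfLE n.le_succ) = skeletonSucc T X I n :=
  Functor.ofSequence_map_homOfLE_succ _ n

variable (T X I) in
/-- The inclusion of `T (X_k, I^k)` in the `n`-th stage of the skeletal filtration, for `k < n`. -/
noncomputable def skeletonι (n : ℕ) (k : SimplexCategory) (hk : k.len < n) :
    (T.obj (X.obj (op k))).obj (I.obj k) ⟶ (skeletonFunctor T X I).obj n :=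
  (skeleton T X I n).ι k hk

lemma skeletonι_w {n : ℕ} {k l : SimplexCategory} (a : k ⟶ l) (hk : k.len < n) (hl : l.len < n) :
    (T.map (X.map a.op)).app (I.obj k) ≫ skeletonι T X I n k hk =
      (T.obj (X.obj (op l))).map (I.map a) ≫ skeletonι T X I n l hl :=
  (skeleton T X I n).w a hk hl

lemma skeletonFunctor_hom_ext {n : ℕ} {Z : N} {φ φ' : (skeletonFunctor T X I).obj n ⟶ Z}
    (h : ∀ k hk, skeletonι T X I n k hk ≫ φ = skeletonι T X I n k hk ≫ φ') : φ = φ' :=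
  (skeleton T X I n).hom_ext h

lemma skeletonι_map {n m : ℕ} (a : n ⟶ m) (k : SimplexCategory) (hk : k.len < n) :
    skeletonι T X I n k hk ≫ (skeletonFunctor T X I).map a =
      skeletonι T X I m k (hk.trans_le (leOfHom a)) := by
  have key (h : n ≤ m) : skeletonι T X I n k hk ≫ (skeletonFunctor T X I).map (homOfLE h) =
      skeletonι T X I m k (hk.trans_le h) := by
    induction m, h using Nat.le_induction with
    | base => exact (congrArg _ ((skeletonFunctor T X I).map_id n)).trans (Category.comp_id _)
    | succ m h ih =>
      rw [← homOfLE_comp h m.le_succ, Functor.map_comp, reassoc_of% (ih (homOfLE h)),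
        skeletonFunctor_map_succ]
      exact ι_skeletonSucc k (hk.trans_le h) _
  exact key (leOfHom a)

lemma skeletonι_comp_app {s : Cocone (skeletonFunctor T X I)} {n m : ℕ} (h : n ≤ m)
    (k : SimplexCategory) (hk : k.len < n) :
    skeletonι T X I n k hk ≫ s.ι.app n =
      skeletonι T X I m k (hk.trans_le h) ≫ s.ι.app m := by
  rw [← s.w (homOfLE h), reassoc_of% (skeletonι_map (homOfLE h) k hk)]

lemma exists_skeletonFunctor_map (f : X ⟶ Y) (g : I ⟶ J) :
    ∃ τ : skeletonFunctor T X I ⟶ skeletonFunctor T Y J, ∀ n k hk,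
      skeletonι T X I n k hk ≫ τ.app n =
        ((T.map (f.app (op k))).app (I.obj k) ≫ (T.obj (Y.obj (op k))).map (g.app k)) ≫
          skeletonι T Y J n k hk := by
  have (n : ℕ) : ∃ φ : (skeletonFunctor T X I).obj n ⟶ (skeletonFunctor T Y J).obj n, ∀ k hk,
      skeletonι T X I n k hk ≫ φ =
        ((T.map (f.app (op k))).app (I.obj k) ≫ (T.obj (Y.obj (op k))).map (g.app k)) ≫
          skeletonι T Y J n k hk :=
    PartialCoend.exists_map (skeleton T X I n) (skeleton T Y J n) f g
  choose φ hφ using this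
  refine ⟨{ app := φ, naturality := fun n m a => ?_ }, hφ⟩
  refine skeletonFunctor_hom_ext fun k hk => ?_
  rw [reassoc_of% (skeletonι_map a k hk), hφ, reassoc_of% (hφ n k hk), skeletonι_map,
    Category.assoc]

/-- The coend receives compatible maps from its skeleta. -/
lemma exists_skeletonCocone (K : PartialCoend T X I (fun _ => True)) :
    ∃ s : skeletonFunctor T X I ⟶ (Functor.const ℕ).obj K.pt, ∀ n k hk,
      skeletonι T X I n k hk ≫ s.app n = K.ι k trivial := by
  have (n : ℕ) : ∃ φ : (skeletonFunctor T X I).obj n ⟶ K.pt, ∀ k hk,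
      skeletonι T X I n k hk ≫ φ = K.ι k trivial :=
    PartialCoend.exists_incl (fun _ _ => trivial) (skeleton T X I n) K
  choose φ hφ using this
  refine ⟨{ app := φ, naturality := fun n m a => Eq.trans ?_ (Category.comp_id _).symm }, hφ⟩
  refine skeletonFunctor_hom_ext fun k hk => ?_
  rw [reassoc_of% (skeletonι_map a k hk), hφ, hφ]

/-- The inclusions of the skeleta in the coend. -/
noncomputable abbrev skeletonCocone (K : PartialCoend T X I (fun _ => True)) :
    Cocone (skeletonFunctor T X I) where
  pt := K.pt
  ι := (exists_skeletonCocone K).choose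

lemma skeletonι_skeletonCocone (K : PartialCoend T X I (fun _ => True)) {n : ℕ}
    (k : SimplexCategory) (hk : k.len < n) :
    skeletonι T X I n k hk ≫ (skeletonCocone K).ι.app n = K.ι k trivial :=
  (exists_skeletonCocone K).choose_spec n k hk

lemma nonempty_isColimit_skeletonCocone (K : PartialCoend T X I (fun _ => True)) :
    Nonempty (IsColimit (skeletonCocone K)) := by
  have key (s : Cocone (skeletonFunctor T X I)) : ∃ φ : (skeletonCocone K).pt ⟶ s.pt,
      ∀ k (n : ℕ) (hk : k.len < n), K.ι k trivial ≫ φ = skeletonι T X I n k hk ≫ s.ι.app n := by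
    obtain ⟨φ, hφ⟩ := K.exists_desc (Z := s.pt)
      (fun k _ => skeletonι T X I (k.len + 1) k k.len.lt_succ_self ≫ s.ι.app (k.len + 1))
      (fun {k l} a _ _ => by
        rw [skeletonι_comp_app (le_max_left (k.len + 1) (l.len + 1)),
          skeletonι_comp_app (le_max_right (k.len + 1) (l.len + 1)), ← Category.assoc,
          skeletonι_w a _ (Nat.lt_of_succ_le (le_max_right _ _)), Category.assoc])
    exact ⟨φ, fun k n hk => (hφ k trivial).trans (skeletonι_comp_app hk k _)⟩
  choose φ hφ using key
  refine ⟨{ desc := φ, fac := fun s n => ?_, uniq := fun s m hm => ?_ }⟩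
  · refine skeletonFunctor_hom_ext fun k hk => ?_
    rw [← Category.assoc, skeletonι_skeletonCocone]
    exact hφ s k n hk
  · refine K.hom_ext fun k hk => ?_
    rw [hφ s k _ k.len.lt_succ_self, ← hm (k.len + 1), ← Category.assoc, skeletonι_skeletonCocone]

end

section

variable {M : Type u₁} [Category.{v₁} M] [ModelCategory M] {V : Type u₂} [Category.{v₂} V]
  [ModelCategory V] {N : Type u₃} [Category.{v₃} N] [ModelCategory N] {T : M ⥤ V ⥤ N}
  {X Y : SimplexCategoryᵒᵖ ⥤ M} {I J : SimplexCategory ⥤ V}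

/-- Reedy cofibrancy of a simplicial object, for all choices of the latching objects as
`ArrowColimit`s. -/
abbrev IsDegeneracyCofibrant (X : SimplexCategoryᵒᵖ ⥤ M) : Prop :=
  IsLatchingCofibrant (MorphismProperty.epimorphisms SimplexCategory).op opLen X

/-- Reedy cofibrancy of a cosimplicial object, for all choices of the latching objects as
`ArrowColimit`s. -/
abbrev IsFaceCofibrant (I : SimplexCategory ⥤ V) : Prop :=
  IsLatchingCofibrant (MorphismProperty.monomorphisms SimplexCategory) SimplexCategory.len I

lemma cofibration_skeletonSucc [HasColimitsOfSize.{0, 0} N] (hT : IsLeftQuillenBifunctor T)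
    (hX : IsDegeneracyCofibrant X) (hI : IsFaceCofibrant I) (n : ℕ) :
    Cofibration (skeletonSucc T X I n) := by
  let d := SimplexCategory.mk n
  obtain ⟨L⟩ := nonempty_arrowColimit X (degeneracyArrows d) (finite_degeneracyArrows d)
  obtain ⟨L'⟩ := nonempty_arrowColimit I (faceArrows d) (finite_faceArrows d)
  obtain ⟨f, k, -, -, hk, sq⟩ := PartialCoend.exists_isPushout (d := d)
    (fun k => Nat.lt_succ_iff) (fun k => Iff.rfl) L L' hT.isLeftAdjoint_obj
    hT.isLeftAdjoint_flip_obj (.ofHasPushout T L.toObj L'.toObj) (skeleton T X I n)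
    (skeleton T X I (n + 1)) n.lt_succ_self
  have : k = skeletonSucc T X I n := (skeleton T X I n).hom_ext fun m hm => by
    rw [hk m hm (Nat.lt_succ_of_lt hm), ι_skeletonSucc]
  rw [← this, cofibration_iff]
  exact MorphismProperty.of_isPushout sq
    (hT.cofibration_pushoutObjObj _ (hX _ L _ L.ι_toObj) (hI _ L' _ L'.ι_toObj)).mem

lemma isCofibrant_skeleton [HasColimitsOfSize.{0, 0} N] (hT : IsLeftQuillenBifunctor T)
    (hX : IsDegeneracyCofibrant X) (hI : IsFaceCofibrant I) (n : ℕ) :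
    IsCofibrant (skeleton T X I n).pt := by
  induction n with
  | zero =>
    have h : IsInitial (skeleton T X I 0).pt := IsInitial.ofUniqueHom
      (fun Z => ((skeleton T X I 0).exists_desc (fun _ hk => (Nat.not_lt_zero _ hk).elim)
        (fun _ hk => (Nat.not_lt_zero _ hk).elim)).choose)
      (fun Z m => (skeleton T X I 0).hom_ext fun _ hk => (Nat.not_lt_zero _ hk).elim)
    exact (isCofibrant_iff_of_isInitial (𝟙 _) h).mpr inferInstance
  | succ n ih =>
    have := cofibration_skeletonSucc hT hX hI n
    exact isCofibrant_of_cofibration (skeletonSucc T X I n)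

/-- The map of skeleta induced by Reedy weak equivalences is a weak equivalence, by induction using
the gluing lemma. -/
lemma weakEquivalence_skeleton [HasColimitsOfSize.{0, 0} N] (hT : IsLeftQuillenBifunctor T)
    (f : X ⟶ Y) (g : I ⟶ J) (hX : IsDegeneracyCofibrant X) (hY : IsDegeneracyCofibrant Y)
    (hI : IsFaceCofibrant I) (hJ : IsFaceCofibrant J) (hf : ∀ n, WeakEquivalence (f.app n))
    (hg : ∀ n, WeakEquivalence (g.app n)) (n : ℕ)
    (φ : (skeleton T X I n).pt ⟶ (skeleton T Y J n).pt)
    (hφ : ∀ k hk, (skeleton T X I n).ι k hk ≫ φ =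
      ((T.map (f.app (op k))).app (I.obj k) ≫ (T.obj (Y.obj (op k))).map (g.app k)) ≫
        (skeleton T Y J n).ι k hk) : WeakEquivalence φ := by
  induction n with
  | zero =>
    obtain ⟨ψ, -⟩ := (skeleton T Y J 0).exists_desc (Z := (skeleton T X I 0).pt)
      (fun _ hk => (Nat.not_lt_zero _ hk).elim) (fun _ hk => (Nat.not_lt_zero _ hk).elim)
    have : IsIso φ :=
      ⟨ψ, (skeleton T X I 0).hom_ext fun _ hk => (Nat.not_lt_zero _ hk).elim,
        (skeleton T Y J 0).hom_ext fun _ hk => (Nat.not_lt_zero _ hk).elim⟩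
    infer_instance
  | succ n ih =>
    let d := SimplexCategory.mk n
    obtain ⟨L⟩ := nonempty_arrowColimit X (degeneracyArrows d) (finite_degeneracyArrows d)
    obtain ⟨L'⟩ := nonempty_arrowColimit I (faceArrows d) (finite_faceArrows d)
    obtain ⟨R⟩ := nonempty_arrowColimit Y (degeneracyArrows d) (finite_degeneracyArrows d)
    obtain ⟨R'⟩ := nonempty_arrowColimit J (faceArrows d) (finite_faceArrows d)
    have hL : Cofibration L.toObj := hX _ L _ L.ι_toObj
    have hL' : Cofibration L'.toObj := hI _ L' _ L'.ι_toObj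
    have hR : Cofibration R.toObj := hY _ R _ R.ι_toObj
    have hR' : Cofibration R'.toObj := hJ _ R' _ R'.ι_toObj
    have hLR := isDirect_op_epimorphisms.preservesWeakEquivalence
      (fun c => finite_degeneracyArrows c.unop) hX hY f hf (op d)
    have hLR' := isDirect_monomorphisms.preservesWeakEquivalence finite_faceArrows hI hJ g hg d
    obtain ⟨α, hα⟩ := L.exists_map R f
    obtain ⟨κ, hκ⟩ := L'.exists_map R' g
    have := hLR.isCofibrant_left L
    have := hLR.isCofibrant_right R
    have := hLR.weakEquivalence L R α hα
    have := hLR'.isCofibrant_left L'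
    have := hLR'.isCofibrant_right R'
    have := hLR'.weakEquivalence L' R' κ hκ
    have hi : L.toObj ≫ f.app (op d) = α ≫ R.toObj := L.hom_ext fun σ hσ => by
      rw [← Category.assoc, L.ι_toObj, reassoc_of% (hα σ hσ), R.ι_toObj, f.naturality]
    have hj : L'.toObj ≫ g.app d = κ ≫ R'.toObj := L'.hom_ext fun δ hδ => by
      rw [← Category.assoc, L'.ι_toObj, reassoc_of% (hκ δ hδ), R'.ι_toObj, g.naturality]
    obtain ⟨sq⟩ : Nonempty (T.PushoutObjObj L.toObj L'.toObj) := ⟨.ofHasPushout _ _ _⟩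
    obtain ⟨sq'⟩ : Nonempty (T.PushoutObjObj R.toObj R'.toObj) := ⟨.ofHasPushout _ _ _⟩
    obtain ⟨ψ, hψ₁, hψ₂, hψ₃⟩ := exists_pushoutObjObj_map sq sq' hi hj
    have hwψ := hT.weakEquivalence_pushoutObjObj sq sq' hi hj ψ hψ₁ hψ₂
    have : IsCofibrant (X.obj (op d)) := isCofibrant_of_cofibration L.toObj
    have : IsCofibrant (Y.obj (op d)) := isCofibrant_of_cofibration R.toObj
    have : IsCofibrant (I.obj d) := isCofibrant_of_cofibration L'.toObj
    have : IsCofibrant (J.obj d) := isCofibrant_of_cofibration R'.toObj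
    have := hT.isCofibrant_pushoutObjObj sq
    have := hT.isCofibrant_pushoutObjObj sq'
    have := hT.cofibration_pushoutObjObj sq hL hL'
    have := hT.cofibration_pushoutObjObj sq' hR hR'
    have := hT.weakEquivalence_map (f.app (op d)) (g.app d)
    have := isCofibrant_skeleton hT hX hI n
    have := isCofibrant_skeleton hT hY hJ n
    obtain ⟨p, k, hp₁, hp₂, hk, sqX⟩ := PartialCoend.exists_isPushout (d := d)
      (fun k => Nat.lt_succ_iff) (fun k => Iff.rfl) L L' hT.isLeftAdjoint_obj
      hT.isLeftAdjoint_flip_obj sq (skeleton T X I n) (skeleton T X I (n + 1)) n.lt_succ_self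
    obtain ⟨p', k', hp₁', hp₂', hk', sqY⟩ := PartialCoend.exists_isPushout (d := d)
      (fun k => Nat.lt_succ_iff) (fun k => Iff.rfl) R R' hT.isLeftAdjoint_obj
      hT.isLeftAdjoint_flip_obj sq' (skeleton T Y J n) (skeleton T Y J (n + 1)) n.lt_succ_self
    obtain ⟨φ', hφ'⟩ := (skeleton T X I n).exists_map (skeleton T Y J n) f g
    have := ih φ' hφ'
    refine weakEquivalence_of_isPushout sqX sqY (α := ψ) (β := φ') ?_ hψ₃.symm ?_
      (hφ d n.lt_succ_self)
    · apply sq.hom_ext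
      · rw [reassoc_of% hψ₁]
        refine PartialCoend.hom_ext_right hT.isLeftAdjoint_obj L' _ fun {m} δ hδ => ?_
        rw [reassoc_of% (hp₁ δ hδ hδ.2), hφ', NatTrans.naturality_assoc,
          ← Functor.map_comp_assoc, hκ, Functor.map_comp, Category.assoc, Category.assoc,
          hp₁' δ hδ hδ.2,
          NatTrans.naturality_assoc, ← NatTrans.comp_app_assoc, ← T.map_comp, f.naturality,
          T.map_comp, NatTrans.comp_app]
        simp only [Category.assoc]
      · rw [reassoc_of% hψ₂]
        refine PartialCoend.hom_ext_left hT.isLeftAdjoint_flip_obj L _ fun {m} σ hσ => ?_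
        rw [reassoc_of% (hp₂ σ hσ hσ.2), hφ', ← NatTrans.comp_app_assoc, ← T.map_comp, hα,
          T.map_comp, NatTrans.comp_app, Category.assoc, Category.assoc,
          ← NatTrans.naturality_assoc (T.map (R.ι σ hσ)), hp₂' σ hσ hσ.2,
          ← Functor.map_comp_assoc, ← g.naturality, Functor.map_comp]
        simp only [Category.assoc, NatTrans.naturality_assoc]
    · refine (skeleton T X I n).hom_ext fun m hm => ?_
      rw [reassoc_of% (hk m hm (Nat.lt_succ_of_lt hm)), hφ, reassoc_of% (hφ' m hm),
        hk' m hm (Nat.lt_succ_of_lt hm), Category.assoc]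

/-- A left Quillen bifunctor turns pairs of weak equivalences between Reedy cofibrant simplicial
and cosimplicial objects into weak equivalences of coends. -/
lemma weakEquivalence_coend [HasColimitsOfSize.{0, 0} N] (hT : IsLeftQuillenBifunctor T)
    (f : X ⟶ Y) (g : I ⟶ J) (hX : IsDegeneracyCofibrant X) (hY : IsDegeneracyCofibrant Y)
    (hI : IsFaceCofibrant I) (hJ : IsFaceCofibrant J) (hf : ∀ n, WeakEquivalence (f.app n))
    (hg : ∀ n, WeakEquivalence (g.app n)) (K : PartialCoend T X I (fun _ => True))
    (K' : PartialCoend T Y J (fun _ => True)) (φ : K.pt ⟶ K'.pt)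
    (hφ : ∀ k, K.ι k trivial ≫ φ =
      ((T.map (f.app (op k))).app (I.obj k) ≫ (T.obj (Y.obj (op k))).map (g.app k)) ≫
        K'.ι k trivial) : WeakEquivalence φ := by
  obtain ⟨τ, hτ⟩ := exists_skeletonFunctor_map (T := T) f g
  obtain ⟨h⟩ := nonempty_isColimit_skeletonCocone K
  obtain ⟨h'⟩ := nonempty_isColimit_skeletonCocone K'
  have : IsCofibrant ((skeletonFunctor T X I).obj 0) := isCofibrant_skeleton hT hX hI 0
  have : IsCofibrant ((skeletonFunctor T Y J).obj 0) := isCofibrant_skeleton hT hY hJ 0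
  refine weakEquivalence_of_isColimit_nat τ h h' (φ := φ) (fun n => ?_) (fun n => ?_)
    (fun n => ?_) (fun n => weakEquivalence_skeleton hT f g hX hY hI hJ hf hg n _ (hτ n))
  · refine skeletonFunctor_hom_ext fun k hk => ?_
    rw [reassoc_of% (skeletonι_skeletonCocone K k hk), reassoc_of% (hτ n k hk),
      skeletonι_skeletonCocone, hφ, Category.assoc]
  · rw [skeletonFunctor_map_succ]
    exact cofibration_skeletonSucc hT hX hI n
  · rw [skeletonFunctor_map_succ]
    exact cofibration_skeletonSucc hT hY hJ n

end

end Reedy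

/-! ### Tensors form a left Quillen bifunctor -/

section

variable (V : Type u') [Category.{v'} V] [MonoidalCategory V]
  {M : Type u} [Category.{v} M] [EnrichedOrdinaryCategory V M]

lemma TensoredCategory.homEquiv_tensorMap_comp [TensoredCategory V M] {X Y B : M} {K L : V}
    (f : X ⟶ Y) (k : K ⟶ L) (g : tensor Y L ⟶ B) :
    homEquiv V X K B (tensorMap f k ≫ g) =
      k ≫ homEquiv V Y L B g ≫ eHomWhiskerRight V f B := by
  rw [homEquiv_apply, homEquiv_apply, eHomWhiskerLeft_comp, reassoc_of% (unit_tensorMap f k),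
    ← eHom_whisker_exchange, Category.assoc]

lemma TensoredCategory.isLeftAdjoint_tensorBifunctor_obj [TensoredCategory V M] (X : M) :
    ((tensorBifunctor V M).obj X).IsLeftAdjoint :=
  (Adjunction.adjunctionOfEquivRight (F := (tensorBifunctor V M).obj X)
    (fun K B => homEquiv V X K B) (fun K K' B k g => by
      refine (homEquiv_tensorMap_comp V (𝟙 X) k g).trans ?_
      rw [eHomWhiskerRight_id, Category.comp_id]
      rfl)).isLeftAdjoint

lemma CotensoredCategory.bijective_counit_comp [CotensoredCategory V M] (K : V) (A B : M) :
    Function.Bijective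
      (fun g : A ⟶ cotensor K B => counit (V := V) K B ≫ eHomWhiskerRight V g B) := by
  have h := (bijective K (𝟙_ V) A B).comp (eHomEquiv V (X := A) (Y := cotensor K B)).bijective
  have h' : Function.Bijective (fun φ : 𝟙_ V ⊗ K ⟶ (A ⟶[V] B) => (λ_ K).inv ≫ φ) :=
    ((λ_ K).homFromEquiv (Z := (A ⟶[V] B))).bijective
  convert h'.comp h using 1
  funext g
  simp [eHomWhiskerRight, MonoidalCategory.tensorHom_def']

/-- Morphisms `A ⟶ B ^ K` correspond to morphisms `K ⟶ (A ⟶[V] B)`. -/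
noncomputable def CotensoredCategory.homEquiv [CotensoredCategory V M] (K : V) (A B : M) :
    (A ⟶ cotensor K B) ≃ (K ⟶ (A ⟶[V] B)) :=
  Equiv.ofBijective _ (bijective_counit_comp V K A B)

lemma CotensoredCategory.homEquiv_comp [CotensoredCategory V M] {K : V} {A A' B : M}
    (f : A' ⟶ A) (g : A ⟶ cotensor K B) :
    homEquiv V K A' B (f ≫ g) = homEquiv V K A B g ≫ eHomWhiskerRight V f B := by
  simp [homEquiv]

lemma TensoredCategory.isLeftAdjoint_flip_tensorBifunctor_obj [TensoredCategory V M]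
    [CotensoredCategory V M] (K : V) : ((tensorBifunctor V M).flip.obj K).IsLeftAdjoint :=
  (Adjunction.adjunctionOfEquivRight (F := (tensorBifunctor V M).flip.obj K)
    (fun X B => (homEquiv V X K B).trans (CotensoredCategory.homEquiv V K X B).symm)
    (fun X X' B f g => by
      apply (CotensoredCategory.homEquiv V K X B).injective
      rw [CotensoredCategory.homEquiv_comp]
      refine ((CotensoredCategory.homEquiv V K X B).apply_symm_apply _).trans ?_
      refine ((homEquiv_tensorMap_comp V f (𝟙 K) g).trans (Category.id_comp _)).trans ?_
      exact congrArg (· ≫ eHomWhiskerRight V f B)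
        ((CotensoredCategory.homEquiv V K X' B).apply_symm_apply _).symm)).isLeftAdjoint

lemma PushoutProductAxiom.isLeftQuillenBifunctor [ModelCategory V] [ModelCategory M]
    [TensoredCategory V M] [CotensoredCategory V M] [PushoutProductAxiom V M] :
    IsLeftQuillenBifunctor (TensoredCategory.tensorBifunctor V M) where
  isLeftAdjoint_obj := TensoredCategory.isLeftAdjoint_tensorBifunctor_obj V
  isLeftAdjoint_flip_obj := TensoredCategory.isLeftAdjoint_flip_tensorBifunctor_obj V
  cofibration_ι := cofibration
  weakEquivalence_ι_left := weakEquivalence_left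
  weakEquivalence_ι_right := weakEquivalence_right

end

/-! ### Comparison of the descriptions of latching objects -/

lemma HomotopicalAlgebra.cofibration_of_cofibration_colimit_desc {C : Type u} [Category.{v} C]
    [ModelCategory C] {J : Type v'} [Category.{u'} J] {D : J ⥤ C} [HasColimit D] {c s : Cocone D}
    (hc : IsColimit c) (hs : Cofibration (colimit.desc D s)) (g : c.pt ⟶ s.pt)
    (hg : ∀ j, c.ι.app j ≫ g = s.ι.app j) : Cofibration g := by
  have : g = (colimit.isoColimitCocone ⟨c, hc⟩).inv ≫ colimit.desc D s := hc.hom_ext fun j => by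
    rw [hg, ← Category.assoc]
    exact ((congrArg (· ≫ _) (colimit.isoColimitCocone_ι_inv ⟨c, hc⟩ j)).trans
      (colimit.ι_desc s j)).symm
  rw [this]
  infer_instance

namespace Reedy

variable {C : Type u} [Category.{v} C] [ModelCategory C]

lemma _root_.IsReedyCofibrantCosimplicial.isFaceCofibrant {I : SimplexCategory ⥤ C}
    (hI : IsReedyCofibrantCosimplicial I) : IsFaceCofibrant I := fun n L g hg => by
  let c : Cocone (colatchingDiagram I n) :=
    { pt := L.pt
      ι :=
        { app := fun δ => L.ι δ.obj.hom δ.property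
          naturality := fun δ ε φ => by
            refine (L.w' φ.hom.left ε.obj.hom ε.property δ.obj.hom δ.property
              (Over.w φ.hom)).trans (Category.comp_id _).symm } }
  have key (s : Cocone (colatchingDiagram I n)) : ∃ φ : L.pt ⟶ s.pt, ∀ δ : InjectionsTo n,
      L.ι δ.obj.hom δ.property ≫ φ = s.ι.app δ := by
    obtain ⟨φ, hφ⟩ := L.exists_desc (fun {m} δ hδ => s.ι.app ⟨Over.mk δ, hδ⟩)
      (fun {m m'} v δ hδ hvδ => s.w (j' := ⟨Over.mk (v ≫ δ), hvδ⟩) (j := ⟨Over.mk δ, hδ⟩)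
        (ObjectProperty.homMk (Over.homMk (U := Over.mk (v ≫ δ)) (V := Over.mk δ) v)))
    exact ⟨φ, fun δ => hφ δ.obj.hom δ.property⟩
  choose desc hdesc using key
  have hc : IsColimit c :=
    { desc := desc
      fac := hdesc
      uniq := fun s m hm => L.hom_ext fun {b} δ hδ =>
        (hm ⟨Over.mk δ, hδ⟩).trans (hdesc s ⟨Over.mk δ, hδ⟩).symm }
  exact cofibration_of_cofibration_colimit_desc hc (hI n) g fun δ => hg _ _

lemma _root_.IsReedyCofibrantSimplicial.isDegeneracyCofibrant {X : SimplexCategoryᵒᵖ ⥤ C}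
    (hX : IsReedyCofibrantSimplicial X) : IsDegeneracyCofibrant X := fun n L g hg => by
  obtain ⟨n⟩ := n
  let c : Cocone (latchingDiagram X n) :=
    { pt := L.pt
      ι :=
        { app := fun σ => L.ι σ.unop.obj.hom.op σ.unop.property
          naturality := fun σ τ φ => by
            refine (L.w' φ.unop.hom.right.op τ.unop.obj.hom.op τ.unop.property σ.unop.obj.hom.op
              σ.unop.property (congrArg Quiver.Hom.op (Under.w φ.unop.hom))).trans
              (Category.comp_id _).symm } }
  have key (s : Cocone (latchingDiagram X n)) : ∃ φ : L.pt ⟶ s.pt,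
      ∀ σ : (SurjectionsFrom n)ᵒᵖ,
        L.ι σ.unop.obj.hom.op σ.unop.property ≫ φ = s.ι.app σ := by
    obtain ⟨φ, hφ⟩ := L.exists_desc (fun {m} σ hσ => s.ι.app (op ⟨Under.mk σ.unop, hσ⟩))
      (fun {m m'} v σ hσ hvσ => s.w (j' := op ⟨Under.mk (v ≫ σ).unop, hvσ⟩)
        (j := op ⟨Under.mk σ.unop, hσ⟩) (Quiver.Hom.op (ObjectProperty.homMk
          (Under.homMk (U := Under.mk σ.unop) (V := Under.mk (v ≫ σ).unop) v.unop))))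
    exact ⟨φ, fun σ => hφ σ.unop.obj.hom.op σ.unop.property⟩
  choose desc hdesc using key
  have hc : IsColimit c :=
    { desc := desc
      fac := hdesc
      uniq := fun s m hm => L.hom_ext fun {b} σ hσ =>
        (hm (op ⟨Under.mk σ.unop, hσ⟩)).trans (hdesc s (op ⟨Under.mk σ.unop, hσ⟩)).symm }
  exact cofibration_of_cofibration_colimit_desc hc (hX n) g fun σ => hg _ _

end Reedy

/-! ### Homotopy invariance of coends of tensors -/

theorem theorem1p1 {M : Type u} [Category.{w} M] [ModelCategory M] [HasColimits M]
    [ModelCategory KTop.{w}] [EnrichedOrdinaryCategory KTop.{w} M]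
    [TensoredCategory KTop.{w} M] [CotensoredCategory KTop.{w} M] [PushoutProductAxiom KTop.{w} M]
    {X Y : SimplexCategoryᵒᵖ ⥤ M} {I J : SimplexCategory ⥤ KTop.{w}}
    (f : X ⟶ Y) (g : I ⟶ J)
    (hX : IsReedyCofibrantSimplicial X) (hY : IsReedyCofibrantSimplicial Y)
    (hI : IsReedyCofibrantCosimplicial I) (hJ : IsReedyCofibrantCosimplicial J)
    (hf : ∀ n : SimplexCategoryᵒᵖ, WeakEquivalence (f.app n))
    (hg : ∀ n : SimplexCategory, WeakEquivalence (g.app n)) :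
    WeakEquivalence (coend.map (TensoredCategory.simplicialTensorMap f g)) := by
  have : HasColimitsOfSize.{0, 0} M := hasColimitsOfSizeShrink.{0, 0, w, w} M
  refine Reedy.weakEquivalence_coend (PushoutProductAxiom.isLeftQuillenBifunctor KTop.{w}) f g
    hX.isDegeneracyCofibrant hY.isDegeneracyCofibrant hI.isFaceCofibrant hJ.isFaceCofibrant hf hg
    (.ofCoend _ X I) (.ofCoend _ Y J) (coend.map (TensoredCategory.simplicialTensorMap f g))
    fun k => ?_
  refine (coend.ι_map (TensoredCategory.simplicialTensorMap f g) k).trans ?_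
  refine congrArg (· ≫ coend.ι (TensoredCategory.simplicialTensor Y J) k) ?_
  -- `f_k □ g^k` is the composite of `f_k □ I^k` and `Y_k □ g^k`
  refine (congrArg₂ TensoredCategory.tensorMap (Category.comp_id _).symm
    (Category.id_comp _).symm).trans (TensoredCategory.tensorMap_comp _ _ _ _)
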